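/- Let $F$ be a finite rooted forest with vertex set $V(F)$ of size $n$, ordered by $u\le_F v$ if $v$ lies on the path from $u$ to the root of its tree (roots are on top). For a vertex $v$ let $h_v=\#\{u: u\le_F v\}$ be the size of the subtree rooted at $v$, and let $[m]=1+q+\cdots+q^{m-1}$. Let $\mathcal W(F)$ be the set of labelings of $F$, i.e. bijections $w:V(F)\to\{1,\dots,n\}$, and let $\mathcal W_B(F)$ be the set of signed labelings, i.e. injective maps $w:V(F)\to\{\pm1,\dots,\pm n\}$ whose image contains no pair $i,-i$. For $w\in\mathcal W_B(F)$ and vertices $x\le_F u$ let $w_u(x)$ be the label of $x$ in the induced signed labeling of the subtree rooted at $u$: it has the sign of $w(x)$, and absolute value $\#\{y\le_F u: |w(y)|\le |w(x)|\}$. The type B sorting index $\mathrm{sor}_B(F,w)$ is computed by the following algorithm. Start with $0$. For $i=n,n-1,\dots,1$ let $v$ be the vertex with $|w(v)|=i$ and let $u$ be the largest vertex with $u\ge_F v$ and $|w(u)|\le i$, where $w$ is the current labeling. Add $|w_u(v)|-w_u(u)$ to the sorting index if $w(u)>0$, and add $|w_u(v)|-w_u(u)-1$ if $w(u)<0$.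 Then, if $w(v)>0$, interchange the labels of $u$ and $v$; if $w(v)<0$, multiply the labels of $u$ and $v$ by $-1$ (once, if $u=v$) and then interchange them. Let $w'$ be the final labeling; it is a positive labeling. For $w\in\mathcal W(F)$ put $\mathrm{sor}(F,w)=\mathrm{sor}_B(F,w)$. For $\sigma\in S_n$ let $\mathrm{Cyc}(\sigma)$ be the set of minimal elements of the cycles of $\sigma$. A cycle of a signed permutation $\sigma$ of $\{\pm1,\dots,\pm n\}$ is balanced if it does not contain both $a$ and $-a$ for any $a$; let $\mathrm{Cyc}_B(\sigma)$ be the set of all $|m|$ with $m$ an element of minimal absolute value in a balanced cycle of $\sigma$. For $w\in\mathcal W(F)$ define the minimal cycle vertices $$\mathrm{Cyc}(F,w)=\{v: w'(v)\in\mathrm{Cyc}(w\circ (w')^{-1})\},$$ and for $w\in\mathcal W_B(F)$ define $$\mathrm{Cyc}_B(F,w)=\{v: w'(v)\in\mathrm{Cyc}_B(w\circ (w')^{-1})\},$$ where $w\circ(w')^{-1}$ is extended to a signed permutation by $\sigma(-k)=-\sigma(k)$. Then, for all elements $q$ and $t_v$ ($v\in V(F)$) of a commutative $\mathbb Q$-algebra,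 and in particular for indeterminates, $$\sum_{w\in\mathcal W(F)}q^{\mathrm{sor}(F,w)}\prod_{v\in\mathrm{Cyc}(F,w)}t_v=\frac{n!}{\prod_{v\in V(F)}h_v}\prod_{v\in V(F)}\left([h_v]-1+t_v\right),$$ $$\sum_{w\in\mathcal W_B(F)}q^{\mathrm{sor}_B(F,w)}\prod_{v\in\mathrm{Cyc}_B(F,w)}t_v=\frac{n!}{\prod_{v\in V(F)}h_v}\prod_{v\in V(F)}\left([2h_v]-1+t_v\right).$$ -/

import Mathlib

open scoped Nat

namespace LabeledForest

/-- A finite poset is (the poset of) a rooted forest with the roots on top when the elements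
lying above any given vertex (its ancestors) form a chain. -/
def IsForest (V : Type*) [PartialOrder V] : Prop :=
  ∀ v a b : V, v ≤ a → v ≤ b → a ≤ b ∨ b ≤ a

/-- The `q`-integer `[m] = 1 + q + ⋯ + q ^ (m - 1)`. -/
def qInt {R : Type*} [CommRing R] (q : R) (m : ℕ) : R := ∑ i ∈ Finset.range m, q ^ i

/-! ### Permutations and signed permutations

An element of `S_n` is a permutation of `ℤ` that fixes everything outside `{1, …, n}`; an element
of `B_n` is a permutation `σ` of `ℤ` with `σ (-k) = -σ k` that fixes everything outside
`{-n, …, n}`. -/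

/-- `σ ∈ S_n`. -/
def IsPerm (n : ℕ) (σ : Equiv.Perm ℤ) : Prop :=
  ∀ k : ℤ, ¬ (1 ≤ k ∧ k ≤ n) → σ k = k

/-- `σ ∈ B_n`. -/
def IsSignedPerm (n : ℕ) (σ : Equiv.Perm ℤ) : Prop :=
  (∀ k : ℤ, σ (-k) = -σ k) ∧ ∀ k : ℤ, (n : ℤ) < |k| → σ k = k

/-- The minimal elements of the cycles of `σ ∈ S_n`. -/
def permCyc (n : ℕ) (σ : Equiv.Perm ℤ) : Set ℤ :=
  {m | 1 ≤ m ∧ m ≤ n ∧ ∀ k, σ.SameCycle m k → m ≤ k}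

/-- The cycle of `σ` through `m` is balanced: no number occurs in it together with its negative. -/
def IsBalanced (σ : Equiv.Perm ℤ) (m : ℤ) : Prop :=
  ∀ k, σ.SameCycle m k → ¬ σ.SameCycle m (-k)

/-- The set of all `|m|`, where `m` is of minimal absolute value in a balanced cycle of
`σ ∈ B_n`. -/
def permCycB (n : ℕ) (σ : Equiv.Perm ℤ) : Set ℤ :=
  {a | ∃ m : ℤ, m ≠ 0 ∧ |m| ≤ n ∧ IsBalanced σ m ∧ (∀ k, σ.SameCycle m k → |m| ≤ |k|) ∧ a = |m|}

/-! ### Labelings -/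

section

variable {V : Type*} [Fintype V]

/-- `w` is a bijection from `V` onto `{1, …, n}`, where `n = |V|`. -/
def IsLabeling (w : V → ℤ) : Prop :=
  Set.BijOn w Set.univ (Set.Icc 1 (Fintype.card V : ℤ))

/-- `w` is a one-to-one map from `V` to `{±1, …, ±n}`, where `n = |V|`, whose image does not
contain both `i` and `-i` for any `i`. -/
def IsSignedLabeling (w : V → ℤ) : Prop :=
  Function.Injective w ∧ (∀ v, w v ≠ 0 ∧ |w v| ≤ Fintype.card V) ∧
    ∀ i ∈ Set.range w, -i ∉ Set.range w

variable (V)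

open Classical in
/-- The set of all labelings. -/
noncomputable def labelings : Finset (V → ℤ) :=
  (Fintype.piFinset fun _ => Finset.Icc (1 : ℤ) (Fintype.card V)).filter IsLabeling

open Classical in
/-- The set of all signed labelings. -/
noncomputable def signedLabelings : Finset (V → ℤ) :=
  (Fintype.piFinset fun _ =>
    Finset.Icc (-(Fintype.card V : ℤ)) (Fintype.card V)).filter IsSignedLabeling

theorem mem_labelings (w : V → ℤ) : w ∈ labelings V ↔ IsLabeling w := by
  simp only [labelings, Finset.mem_filter, Fintype.mem_piFinset, Finset.mem_Icc,
    and_iff_right_iff_imp]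
  exact fun h v => h.mapsTo (Set.mem_univ v)

theorem mem_signedLabelings (w : V → ℤ) : w ∈ signedLabelings V ↔ IsSignedLabeling w := by
  simp only [signedLabelings, Finset.mem_filter, Fintype.mem_piFinset, Finset.mem_Icc,
    and_iff_right_iff_imp]
  exact fun h v => abs_le.1 (h.2.1 v).2

end

/-! ### Sorting a labeled forest -/

section

variable {V : Type*} [Fintype V] [PartialOrder V]

open Classical in
/-- `h_v`: the number of vertices of the subtree rooted at `v`. -/
noncomputable def hook (v : V) : ℕ := (Finset.univ.filter fun u => u ≤ v).card

open Classical in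
/-- `w_u(x)`: the label of `x` in the signed labeling of the subtree rooted at `u` induced by `w`;
absolute values are replaced by their ranks inside that subtree and signs are kept. -/
noncomputable def inducedLabel (w : V → ℤ) (u x : V) : ℤ :=
  (w x).sign * (Finset.univ.filter fun y => y ≤ u ∧ |w y| ≤ |w x|).card

/-- In the step with value `i` for the labeling `w`: `v` is a vertex with `|w v| = i`, and `u` is
the largest vertex with `v ≤ u` and `|w u| ≤ i`. -/
def IsStepPair (w : V → ℤ) (i : ℕ) (v u : V) : Prop :=
  |w v| = i ∧ IsGreatest {x | v ≤ x ∧ |w x| ≤ i} u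

open Classical in
/-- What a step with the vertices `v` and `u` adds to the sorting index. -/
noncomputable def stepWeight (w : V → ℤ) (v u : V) : ℤ :=
  if 0 < w u then |inducedLabel w u v| - inducedLabel w u u
  else |inducedLabel w u v| - inducedLabel w u u - 1

open Classical in
/-- The labeling after a step with the vertices `v` and `u`: the labels on `u` and `v` are
interchanged, after both have been multiplied by `-1` in case `w v` is not positive (if `u = v`,
the one label is multiplied by `-1` once). -/
noncomputable def stepLabeling (w : V → ℤ) (v u : V) : V → ℤ :=
  if 0 < w v then w ∘ Equiv.swap u v
  else (fun x => if x = u ∨ x = v then -w x else w x) ∘ Equiv.swap u v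

open Classical in
/-- The step of the algorithm with value `i`: the amount added to the sorting index, and the new
labeling. For a signed labeling of a forest and `1 ≤ i ≤ n` the pair `(v, u)` exists and is
unique, so the last case does not occur. -/
noncomputable def sortStep (i : ℕ) (w : V → ℤ) : ℤ × (V → ℤ) :=
  if h : ∃ p : V × V, IsStepPair w i p.1 p.2 then
    (stepWeight w h.choose.1 h.choose.2, stepLabeling w h.choose.1 h.choose.2)
  else (0, w)

/-- The steps with values `i, i - 1, …, 1`, in this order: the total amount added to the sorting
index, and the final labeling. -/
noncomputable def sortFrom : ℕ → (V → ℤ) → ℤ × (V → ℤ)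
  | 0, w => (0, w)
  | i + 1, w =>
    ((sortStep (i + 1) w).1 + (sortFrom i (sortStep (i + 1) w).2).1,
      (sortFrom i (sortStep (i + 1) w).2).2)

/-- The sorting index of type B. -/
noncomputable def sorB (w : V → ℤ) : ℤ := (sortFrom (Fintype.card V) w).1

/-- The sorting index of type A of a labeling, the same number as its sorting index of type B. -/
noncomputable def sor (w : V → ℤ) : ℤ := sorB w

/-- The labeling `w'` that the algorithm produces from `w`. -/
noncomputable def sorted (w : V → ℤ) : V → ℤ := (sortFrom (Fintype.card V) w).2

open Classical in
/-- The minimal cycle vertices of a labeling `w`: the vertices `v` such that `w' v` is the minimal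
element of a cycle of the permutation `σ = w ∘ w'⁻¹ ∈ S_n`. -/
noncomputable def cyc (w : V → ℤ) : Finset V :=
  Finset.univ.filter fun v => ∃ σ : Equiv.Perm ℤ, IsPerm (Fintype.card V) σ ∧
    (∀ x, σ (sorted w x) = w x) ∧ sorted w v ∈ permCyc (Fintype.card V) σ

open Classical in
/-- The type B minimal cycle vertices of a signed labeling `w`; here `σ ∈ B_n` is the unique
signed permutation that extends `w ∘ w'⁻¹`. -/
noncomputable def cycB (w : V → ℤ) : Finset V :=
  Finset.univ.filter fun v => ∃ σ : Equiv.Perm ℤ, IsSignedPerm (Fintype.card V) σ ∧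
    (∀ x, σ (sorted w x) = w x) ∧ sorted w v ∈ permCycB (Fintype.card V) σ

/-! The sorting index is never negative, so that it can serve as an exponent. -/

theorem stepWeight_nonneg {w : V → ℤ} {i : ℕ} {v u : V} (hi : 1 ≤ i) (h : IsStepPair w i v u) :
    0 ≤ stepWeight w v u := by
  classical
  obtain ⟨hv, ⟨hvu, hu⟩, -⟩ := h
  have hv0 : w v ≠ 0 := by
    intro h0
    rw [h0, abs_zero] at hv
    omega
  have hsv : |(w v).sign| = 1 := by
    rcases lt_or_gt_of_ne hv0 with h | h
    · simp [Int.sign_eq_neg_one_of_neg h]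
    · simp [Int.sign_eq_one_of_pos h]
  have hle : (Finset.univ.filter fun y => y ≤ u ∧ |w y| ≤ |w u|).card ≤
      (Finset.univ.filter fun y => y ≤ u ∧ |w y| ≤ |w v|).card := by
    refine Finset.card_le_card fun y hy => ?_
    simp only [Finset.mem_filter, Finset.mem_univ, true_and] at hy ⊢
    exact ⟨hy.1, hy.2.trans (hu.trans hv.ge)⟩
  have hpos : 0 < (Finset.univ.filter fun y => y ≤ u ∧ |w y| ≤ |w v|).card :=
    Finset.card_pos.2 ⟨v, by simp [hvu]⟩
  have habs : |inducedLabel w u v| =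
      ((Finset.univ.filter fun y => y ≤ u ∧ |w y| ≤ |w v|).card : ℤ) := by
    rw [inducedLabel, abs_mul, hsv, one_mul, Nat.abs_cast]
  unfold stepWeight
  rw [habs]
  split_ifs with h0
  · have : inducedLabel w u u =
        ((Finset.univ.filter fun y => y ≤ u ∧ |w y| ≤ |w u|).card : ℤ) := by
      rw [inducedLabel, Int.sign_eq_one_of_pos h0, one_mul]
    omega
  · have : inducedLabel w u u ≤ 0 :=
      mul_nonpos_of_nonpos_of_nonneg (Int.sign_nonpos_iff.2 (not_lt.1 h0)) (by positivity)
    omega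

theorem sortFrom_nonneg (i : ℕ) (w : V → ℤ) : 0 ≤ (sortFrom i w).1 := by
  induction i generalizing w with
  | zero => exact le_rfl
  | succ i ih =>
    refine add_nonneg ?_ (ih _)
    unfold sortStep
    split_ifs with h
    · exact stepWeight_nonneg (Nat.succ_pos i) h.choose_spec
    · exact le_rfl

theorem sorB_nonneg (w : V → ℤ) : 0 ≤ sorB w := sortFrom_nonneg _ w

end

end LabeledForest

/-! The steps of the algorithm can be undone. A state of level `i` (`IsState`) is a labeling whose
labels beyond `i` in absolute value are already sorted; let `u` be the vertex labeled `i + 1` in it.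
Its predecessors of level `i + 1` correspond to the choices of a vertex `v ≤ u` and a sign
(`IsState.signSwap_inv`). If `v` has rank `r` in the subtree of `u`, the step weighs `h_u - r` or
`h_u + r - 1`, according to the sign of the label on `u` before the step (`stepWeight_signSwap`). So
the exponents run once through `0, …, h_u - 1` without signs and once through `0, …, 2 h_u - 1` with
signs. Exponent `0` belongs to the trivial positive step, and marking that step by `t_u` turns its
`1` into `t_u`.

This factor depends on `u` alone, so summation level by level (`sum_states_card`) gives the product
over all vertices times the number of states of level `0`, the increasing labelings. Unsigned
labelings with `q = 1` and all `t_v = 1` give that number: the hook length formula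
(`card_states_zero`). The sign set `E`, either `{1}` or `{1, -1}`, treats both types at once.

The marked vertices are the minimal cycle vertices (`exists_perm_runFactor`). Undoing the step with
value `i + 1` changes `w ∘ w'⁻¹`, which fixed `i + 1` so far, in one of three ways. A trivial
positive step keeps the fixed point, a balanced cycle; a trivial negative step sends `i + 1` to its
negative, an unbalanced cycle; any other step inserts `i + 1` into the cycle of a number of smaller
absolute value. Minimality and balance of the smaller numbers are not affected. -/

namespace LabeledForest

/-! ### Cycles of permutations -/

/-- Induction on the exponent, in both directions. The invariant set `p` is there because the
permutations compared below are related only on small or only on positive numbers. -/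
theorem sameCycle_map_on {α β : Type*} {σ : Equiv.Perm α} {τ : Equiv.Perm β} (p : α → Prop)
    (f : α → β) (hp : ∀ x, p (σ x) ↔ p x) (h : ∀ x, p x → τ.SameCycle (f x) (f (σ x)))
    {x y : α} (hx : p x) (hxy : σ.SameCycle x y) : p y ∧ τ.SameCycle (f x) (f y) := by
  obtain ⟨n, rfl⟩ := hxy
  induction n using Int.induction_on with
  | zero => exact ⟨hx, Equiv.Perm.SameCycle.refl _ _⟩
  | succ n ih =>
    rw [add_comm, zpow_add, zpow_one, Equiv.Perm.mul_apply]
    exact ⟨(hp _).2 ih.1, ih.2.trans (h _ ih.1)⟩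
  | pred n ih =>
    have e : (σ ^ (-(n : ℤ))) x = σ ((σ ^ (-(n : ℤ) - 1)) x) := by
      rw [← Equiv.Perm.mul_apply, ← zpow_one_add]
      congr 2
      ring
    rw [e] at ih
    have h1 := (hp _).1 ih.1
    exact ⟨h1, ih.2.trans (h _ h1).symm⟩

theorem sameCycle_map {α β : Type*} {σ : Equiv.Perm α} {τ : Equiv.Perm β}
    (f : α → β) (h : ∀ x, τ.SameCycle (f x) (f (σ x)))
    {x y : α} (hxy : σ.SameCycle x y) : τ.SameCycle (f x) (f y) :=
  (sameCycle_map_on (fun _ => True) f (by simp) (fun x _ => h x) trivial hxy).2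

/-- `m` has minimal absolute value in its cycle, and this cycle is balanced. -/
def IsBalancedMin (σ : Equiv.Perm ℤ) (m : ℤ) : Prop :=
  IsBalanced σ m ∧ ∀ k, σ.SameCycle m k → |m| ≤ |k|

theorem isBalancedMin_neg {σ : Equiv.Perm ℤ} (hσ : ∀ k, σ (-k) = -σ k) {m : ℤ}
    (h : IsBalancedMin σ m) : IsBalancedMin σ (-m) := by
  have key : ∀ k, σ.SameCycle (-m) k → σ.SameCycle m (-k) := fun k hk => by
    have := sameCycle_map (τ := σ) (fun z => -z)
      (fun x => by rw [← hσ]; exact Equiv.Perm.sameCycle_apply_right.2 (.refl _ _)) hk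
    simpa using this
  refine ⟨fun k hk hk' => h.1 _ (key k hk) (key _ hk'), fun k hk => ?_⟩
  simpa using h.2 _ (key k hk)

/-- The minimal element may be negative, but negation carries its cycle to that of its absolute
value. -/
theorem mem_permCycB {n : ℕ} {σ : Equiv.Perm ℤ} (hσ : ∀ k, σ (-k) = -σ k) {a : ℤ}
    (ha : 1 ≤ a) (han : a ≤ n) : a ∈ permCycB n σ ↔ IsBalancedMin σ a := by
  have habs : |a| = a := abs_of_pos (by omega)
  constructor
  · rintro ⟨m, -, -, hb, hm, e⟩
    have : IsBalancedMin σ m := ⟨hb, hm⟩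
    rcases abs_choice m with h | h
    · rw [e, h]; exact this
    · rw [e, h]; exact isBalancedMin_neg hσ this
  · rintro ⟨hb, hm⟩
    exact ⟨a, by omega, by omega, hb, hm, habs.symm⟩

/-- Here `τ` has one more letter than `σ`, and `f` removes it from a cycle. Oddness of `f`
transports opposite pairs, and `f` never raises absolute values, so minima survive. -/
theorem isBalancedMin_congr {σ τ : Equiv.Perm ℤ} {m : ℤ} (f : ℤ → ℤ)
    (hf : ∀ k, f (-k) = -f k) (hf' : ∀ k, |f k| ≤ |k|)
    (h : ∀ k, σ.SameCycle m k → τ.SameCycle m k)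
    (h' : ∀ k, τ.SameCycle m k → σ.SameCycle m (f k)) :
    IsBalancedMin τ m ↔ IsBalancedMin σ m := by
  refine ⟨fun H => ⟨fun k hk hk' => H.1 k (h _ hk) (h _ hk'), fun k hk => H.2 k (h _ hk)⟩,
    fun H => ⟨fun k hk hk' => H.1 (f k) (h' _ hk) ?_, fun k hk => (H.2 _ (h' _ hk)).trans (hf' k)⟩⟩
  rw [← hf]
  exact h' _ hk'

/-! ### Adding the letter `i + 1` to a signed permutation. -/

theorem abs_apply_le_iff {i : ℕ} {σ : Equiv.Perm ℤ} (hσ : ∀ k : ℤ, (i : ℤ) < |k| → σ k = k)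
    (k : ℤ) : |σ k| ≤ i ↔ |k| ≤ i := by
  constructor
  · intro h
    by_contra hk
    rw [hσ k (by omega)] at h
    exact hk h
  · intro h
    by_contra hk
    have := σ.injective (hσ (σ k) (by omega))
    rw [this] at hk
    exact hk h

theorem isBalancedMin_of_fixed {σ : Equiv.Perm ℤ} {a : ℤ} (ha : a ≠ 0) (h : σ a = a) :
    IsBalancedMin σ a := by
  have key : ∀ k, σ.SameCycle a k → k = a := fun k hk =>
    ((Equiv.Perm.SameCycle.eq_of_left hk h)).symm
  refine ⟨fun k hk hk' => ?_, fun k hk => by rw [key k hk]⟩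
  have h1 := key _ hk
  have h2 := key _ hk'
  omega

/-- Making a fixed point negative. -/
theorem exists_perm_neg {i : ℕ} {σ : Equiv.Perm ℤ} (hσ : ∀ k, σ (-k) = -σ k)
    (hs : ∀ k : ℤ, (i : ℤ) < |k| → σ k = k) :
    ∃ τ : Equiv.Perm ℤ, (∀ k, τ (-k) = -τ k) ∧ (∀ k : ℤ, ((i + 1 : ℕ) : ℤ) < |k| → τ k = k) ∧
      τ ((i + 1 : ℕ) : ℤ) = -((i + 1 : ℕ) : ℤ) ∧
      (∀ k : ℤ, |k| ≠ (i + 1 : ℕ) → τ k = σ k) ∧ ¬ IsBalancedMin τ ((i + 1 : ℕ) : ℤ) ∧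
      ∀ m : ℤ, |m| ≤ i → (IsBalancedMin τ m ↔ IsBalancedMin σ m) := by
  set a : ℤ := ((i + 1 : ℕ) : ℤ) with ha
  have ha' : a = i + 1 := by push_cast at ha; exact ha
  have hi : (0 : ℤ) ≤ i := Int.natCast_nonneg i
  have habs : |a| = a := abs_of_pos (by omega)
  have hσa : σ a = a := hs a (by omega)
  have hna : σ (-a) = -a := by rw [hσ, hσa]
  set τ := σ * Equiv.swap a (-a) with hτ
  have t1 : τ a = -a := by simp [hτ, hna]
  have t2 : τ (-a) = a := by simp [hτ, hσa]
  have t3 : ∀ k : ℤ, |k| ≠ a → τ k = σ k := fun k hk => by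
    rw [hτ, Equiv.Perm.mul_apply, Equiv.swap_apply_of_ne_of_ne]
    · rintro rfl; exact hk habs
    · rintro rfl; rw [abs_neg] at hk; exact hk habs
  have ts : ∀ k : ℤ, a < |k| → τ k = k := fun k hk => by rw [t3 k hk.ne', hs k (by omega)]
  refine ⟨τ, fun k => ?_, ts, t1, t3, fun H => ?_, fun m hm => ?_⟩
  · by_cases hk : |k| = a
    · rcases (abs_eq (by omega)).1 hk with rfl | rfl
      · rw [t1, t2, neg_neg]
      · rw [t2, neg_neg, t1]
    · rw [t3 k hk, t3 (-k) (by rwa [abs_neg]), hσ]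
  · refine H.1 a (.refl _ _) ?_
    rw [← t1]
    exact Equiv.Perm.sameCycle_apply_right.2 (.refl _ _)
  · have e : ∀ x : ℤ, |x| ≤ i → τ x = σ x := fun x hx => t3 x (by omega)
    refine isBalancedMin_congr id (fun _ => rfl) (fun _ => le_rfl)
      (fun k hk => (sameCycle_map_on (τ := τ) (fun z : ℤ => |z| ≤ i) id (abs_apply_le_iff hs)
        (fun x hx => ?_) hm hk).2)
      (fun k hk => (sameCycle_map_on (τ := σ) (fun z : ℤ => |z| ≤ i) id (fun x => ?_)
        (fun x hx => ?_) hm hk).2)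
    · rw [id, id, ← e x hx]
      exact Equiv.Perm.sameCycle_apply_right.2 (.refl _ _)
    · by_cases hx : |x| = a
      · rcases (abs_eq (by omega)).1 hx with rfl | rfl
        · rw [t1, abs_neg]
        · rw [t2, abs_neg]
      · rw [t3 x hx, abs_apply_le_iff hs]
    · rw [id, id, e x hx]
      exact Equiv.Perm.sameCycle_apply_right.2 (.refl _ _)

/-- Inserting a fixed point into another cycle. -/
theorem exists_perm_insert {i : ℕ} {σ : Equiv.Perm ℤ} (hσ : ∀ k, σ (-k) = -σ k)
    (hs : ∀ k : ℤ, (i : ℤ) < |k| → σ k = k) {b : ℤ} (hb : b ≠ 0) (hbi : |b| ≤ i) :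
    ∃ τ : Equiv.Perm ℤ, (∀ k, τ (-k) = -τ k) ∧ (∀ k : ℤ, ((i + 1 : ℕ) : ℤ) < |k| → τ k = k) ∧
      τ ((i + 1 : ℕ) : ℤ) = σ b ∧ τ b = ((i + 1 : ℕ) : ℤ) ∧
      (∀ k : ℤ, |k| ≠ (i + 1 : ℕ) → |k| ≠ |b| → τ k = σ k) ∧
      ¬ IsBalancedMin τ ((i + 1 : ℕ) : ℤ) ∧
      ∀ m : ℤ, |m| ≤ i → (IsBalancedMin τ m ↔ IsBalancedMin σ m) := by
  set a : ℤ := ((i + 1 : ℕ) : ℤ) with ha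
  have ha' : a = i + 1 := by push_cast at ha; exact ha
  have habs : |a| = a := abs_of_pos (by omega)
  have hσa : σ a = a := hs a (by omega)
  have hna : σ (-a) = -a := by rw [hσ, hσa]
  have hb1 := (abs_le.1 hbi).1
  have hb2 := (abs_le.1 hbi).2
  -- The arrow `b → σ b` becomes `b → a → σ b`; the second transposition does the same to the
  -- negatives and keeps `τ` odd.
  set τ := σ * (Equiv.swap a b * Equiv.swap (-a) (-b)) with hτ
  have t1 : τ a = σ b := by
    rw [hτ, Equiv.Perm.mul_apply, Equiv.Perm.mul_apply,
      Equiv.swap_apply_of_ne_of_ne (a := -a) (by omega) (by omega), Equiv.swap_apply_left]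
  have t2 : τ b = a := by
    rw [hτ, Equiv.Perm.mul_apply, Equiv.Perm.mul_apply,
      Equiv.swap_apply_of_ne_of_ne (a := -a) (by omega) (by omega), Equiv.swap_apply_right, hσa]
  have t1' : τ (-a) = -σ b := by
    rw [hτ, Equiv.Perm.mul_apply, Equiv.Perm.mul_apply, Equiv.swap_apply_left,
      Equiv.swap_apply_of_ne_of_ne (by omega) (by omega), hσ]
  have t2' : τ (-b) = -a := by
    rw [hτ, Equiv.Perm.mul_apply, Equiv.Perm.mul_apply, Equiv.swap_apply_right,
      Equiv.swap_apply_of_ne_of_ne (by omega) (by omega), hna]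
  have t3' : ∀ k : ℤ, k ≠ a → k ≠ -a → k ≠ b → k ≠ -b → τ k = σ k := fun k h1 h2 h3 h4 => by
    rw [hτ, Equiv.Perm.mul_apply, Equiv.Perm.mul_apply,
      Equiv.swap_apply_of_ne_of_ne (a := -a) h2 h4, Equiv.swap_apply_of_ne_of_ne h1 h3]
  have t3 : ∀ k : ℤ, |k| ≠ a → |k| ≠ |b| → τ k = σ k := fun k h1 h2 => by
    refine t3' k ?_ ?_ ?_ ?_
    · rintro rfl; exact h1 habs
    · rintro rfl; rw [abs_neg] at h1; exact h1 habs
    · rintro rfl; exact h2 rfl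
    · rintro rfl; exact h2 (abs_neg b)
  have odd : ∀ k, τ (-k) = -τ k := fun k => by
    by_cases h1 : k = a
    · rw [h1, t1, t1']
    by_cases h2 : k = -a
    · rw [h2, neg_neg, t1, t1', neg_neg]
    by_cases h3 : k = b
    · rw [h3, t2, t2']
    by_cases h4 : k = -b
    · rw [h4, neg_neg, t2, t2', neg_neg]
    rw [t3' k h1 h2 h3 h4, t3' (-k) (by omega) (by omega) (by omega) (by omega), hσ]
  refine ⟨τ, odd, fun k hk => ?_, t1, t2, t3, fun H => ?_, fun m hm => ?_⟩
  · rw [t3 k hk.ne' (by omega), hs k (by omega)]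
  -- The cycle of `a` contains `b`, of smaller absolute value.
  · have h := H.2 b (by
      rw [← t2]; exact Equiv.Perm.sameCycle_apply_left.2 (.refl _ _))
    omega
  -- Collapsing `±a` onto their predecessors `±b` maps cycles of `τ` into cycles of `σ`.
  · set f : ℤ → ℤ := fun z => if z = a then b else if z = -a then -b else z with hf
    have fa : f a = b := by simp [hf]
    have fna : f (-a) = -b := by
      have : -a ≠ a := by omega
      simp [hf, this]
    have fo : ∀ z, z ≠ a → z ≠ -a → f z = z := fun z h1 h2 => by simp [hf, h1, h2]
    have fm : f m = m := fo m (by have := abs_le.1 hm; omega) (by have := abs_le.1 hm; omega)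
    have step : ∀ x, τ.SameCycle x (τ x) := fun x =>
      Equiv.Perm.sameCycle_apply_right.2 (.refl _ _)
    have step' : ∀ x, σ.SameCycle x (σ x) := fun x =>
      Equiv.Perm.sameCycle_apply_right.2 (.refl _ _)
    refine isBalancedMin_congr f (fun k => ?_) (fun k => ?_)
      (fun k hk => (sameCycle_map_on (τ := τ) (fun z : ℤ => |z| ≤ i) id (abs_apply_le_iff hs)
        (fun x hx => ?_) hm hk).2)
      (fun k hk => ?_)
    · by_cases h1 : k = a
      · rw [h1, fa, fna]
      by_cases h2 : k = -a
      · rw [h2, neg_neg, fa, fna, neg_neg]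
      rw [fo k h1 h2, fo (-k) (by omega) (by omega)]
    · by_cases h1 : k = a
      · rw [h1, fa]; omega
      by_cases h2 : k = -a
      · rw [h2, fna, abs_neg, abs_neg]; omega
      rw [fo k h1 h2]
    · have hx' := abs_le.1 hx
      simp only [id]
      by_cases h3 : x = b
      · rw [h3, ← t1]
        have h5 := step b
        rw [t2] at h5
        exact h5.trans (step a)
      by_cases h4 : x = -b
      · rw [h4, hσ, ← t1']
        have h5 := step (-b)
        rw [t2'] at h5
        exact h5.trans (step _)
      rw [← t3' x (by omega) (by omega) h3 h4]
      exact step x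
    · have key := sameCycle_map (τ := σ) f (fun x => ?_) hk
      · rwa [fm] at key
      have nofix : ∀ z, z ≠ a → z ≠ -a → f (σ z) = σ z := fun z h1 h2 => by
        refine fo _ (fun h => h1 (σ.injective (by rw [h, hσa]))) (fun h => h2 (σ.injective ?_))
        rw [h, hna]
      by_cases h1 : x = a
      · rw [h1, fa, t1, nofix b (by omega) (by omega)]; exact step' b
      by_cases h2 : x = -a
      · rw [h2, fna, t1', ← hσ, nofix (-b) (by omega) (by omega)]; exact step' _
      by_cases h3 : x = b
      · rw [h3, t2, fa, fo b (by omega) (by omega)]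
      by_cases h4 : x = -b
      · rw [h4, t2', fna, fo (-b) (by omega) (by omega)]
      rw [t3' x h1 h2 h3 h4, nofix x h1 h2, fo x h1 h2]
      exact step' x

/-! ### Signed interchanges and ranks -/

section

variable {V : Type*}

open Classical in
/-- Interchange the labels of `u` and `v` and multiply them by `ε` (once, if `u = v`). -/
noncomputable def signSwap (w : V → ℤ) (u v : V) (ε : ℤ) : V → ℤ :=
  fun x => if x = v then ε * w u else if x = u then ε * w v else w x

theorem signSwap_right (w : V → ℤ) (u v : V) (ε : ℤ) : signSwap w u v ε v = ε * w u := by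
  simp [signSwap]

theorem signSwap_left (w : V → ℤ) (u v : V) (ε : ℤ) : signSwap w u v ε u = ε * w v := by
  by_cases h : u = v <;> simp [signSwap, h]

theorem signSwap_of_ne (w : V → ℤ) {u v x : V} (ε : ℤ) (hu : x ≠ u) (hv : x ≠ v) :
    signSwap w u v ε x = w x := by
  simp [signSwap, hu, hv]

theorem signSwap_signSwap (w : V → ℤ) (u v : V) {ε : ℤ} (hε : ε = 1 ∨ ε = -1) :
    signSwap (signSwap w u v ε) u v ε = w := by
  have hε2 : ε * ε = 1 := by rcases hε with rfl | rfl <;> rfl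
  funext x
  by_cases hv : x = v
  · rw [hv, signSwap_right, signSwap_left, ← mul_assoc, hε2, one_mul]
  by_cases hu : x = u
  · rw [hu, signSwap_left, signSwap_right, ← mul_assoc, hε2, one_mul]
  rw [signSwap_of_ne _ _ hu hv, signSwap_of_ne _ _ hu hv]

theorem abs_signSwap [DecidableEq V] (w : V → ℤ) (u v : V) {ε : ℤ} (hε : ε = 1 ∨ ε = -1) (x : V) :
    |signSwap w u v ε x| = |w (Equiv.swap u v x)| := by
  have hε2 : |ε| = 1 := by rcases hε with rfl | rfl <;> rfl
  by_cases hv : x = v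
  · rw [hv, signSwap_right, Equiv.swap_apply_right, abs_mul, hε2, one_mul]
  by_cases hu : x = u
  · rw [hu, signSwap_left, Equiv.swap_apply_left, abs_mul, hε2, one_mul]
  rw [signSwap_of_ne _ _ hu hv, Equiv.swap_apply_of_ne_of_ne hu hv]

theorem sign_eq_one_or {x : ℤ} (hx : x ≠ 0) : x.sign = 1 ∨ x.sign = -1 := by
  rcases lt_or_gt_of_ne hx with h | h
  · exact Or.inr (Int.sign_eq_neg_one_of_neg h)
  · exact Or.inl (Int.sign_eq_one_of_pos h)

theorem stepLabeling_eq {w : V → ℤ} {v : V} (u : V) (hv : w v ≠ 0) :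
    stepLabeling w v u = signSwap w u v (w v).sign := by
  classical
  funext x
  unfold stepLabeling
  by_cases h : 0 < w v
  · rw [if_pos h, Int.sign_eq_one_of_pos h]
    by_cases hxv : x = v
    · rw [hxv, signSwap_right]; simp
    by_cases hxu : x = u
    · rw [hxu, signSwap_left]; simp
    rw [signSwap_of_ne _ _ hxu hxv, Function.comp, Equiv.swap_apply_of_ne_of_ne hxu hxv]
  · rw [if_neg h, Int.sign_eq_neg_one_of_neg (by omega)]
    by_cases hxv : x = v
    · rw [hxv, signSwap_right]; simp
    by_cases hxu : x = u
    · rw [hxu, signSwap_left]; simp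
    rw [signSwap_of_ne _ _ hxu hxv, Function.comp, Equiv.swap_apply_of_ne_of_ne hxu hxv]
    simp [hxu, hxv]

/-- A set of signs: a subgroup of `{1, -1}`. -/
structure IsSignSet (E : Finset ℤ) : Prop where
  one_mem : 1 ∈ E
  eq_one_or : ∀ ε ∈ E, ε = 1 ∨ ε = -1

theorem IsSignSet.mul_mem {E : Finset ℤ} (hE : IsSignSet E) {a b : ℤ} (ha : a ∈ E) (hb : b ∈ E) :
    a * b ∈ E := by
  rcases hE.eq_one_or a ha with rfl | rfl
  · simpa using hb
  · rcases hE.eq_one_or b hb with rfl | rfl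
    · simpa using ha
    · simpa using hE.one_mem

theorem sign_signSwap_mem {E : Finset ℤ} (hE : IsSignSet E) {w : V → ℤ}
    (hw : ∀ x, (w x).sign ∈ E) (u v : V) {ε : ℤ} (hε : ε ∈ E) (x : V) :
    (signSwap w u v ε x).sign ∈ E := by
  have hs : ε.sign = ε := by rcases hE.eq_one_or ε hε with rfl | rfl <;> rfl
  by_cases hv : x = v
  · rw [hv, signSwap_right, Int.sign_mul, hs]; exact hE.mul_mem hε (hw _)
  by_cases hu : x = u
  · rw [hu, signSwap_left, Int.sign_mul, hs]; exact hE.mul_mem hε (hw _)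
  rw [signSwap_of_ne _ _ hu hv]; exact hw x

/-- The multiplier is the sign of the label that moves to `u`, so this label arrives positive. -/
theorem IsStepPair.signSwap_left [PartialOrder V] {i : ℕ} {w : V → ℤ} {v u : V}
    (h : IsStepPair w i v u) :
    signSwap w u v (w v).sign u = i := by
  rw [LabeledForest.signSwap_left, Int.sign_mul_self_eq_abs, h.1]

/-- A sum over the elements of a finite set of a function of the rank. -/
theorem sum_rank {M : Type*} [AddCommMonoid M] {s : Finset V} {f : V → ℤ}
    (hf : ∀ x ∈ s, ∀ y ∈ s, f x = f y → x = y) (F : ℕ → M) :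
    ∑ x ∈ s, F (s.filter fun y => f y ≤ f x).card = ∑ k ∈ Finset.range s.card, F (k + 1) := by
  classical
  set r : V → ℕ := fun x => (s.filter fun y => f y ≤ f x).card with hr
  have lt : ∀ x ∈ s, ∀ y ∈ s, f x < f y → r x < r y := fun x _ y hy hxy => by
    refine Finset.card_lt_card (Finset.ssubset_iff_subset_ne.2 ⟨fun z hz => ?_, fun e => ?_⟩)
    · rw [Finset.mem_filter] at hz ⊢
      exact ⟨hz.1, hz.2.trans hxy.le⟩
    · have : y ∈ s.filter fun z => f z ≤ f x := by
        rw [e, Finset.mem_filter]; exact ⟨hy, le_rfl⟩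
      rw [Finset.mem_filter] at this
      omega
  have inj : Set.InjOn r s := fun x hx y hy e => by
    rcases lt_trichotomy (f x) (f y) with h | h | h
    · exact absurd e (lt x hx y hy h).ne
    · exact hf x hx y hy h
    · exact absurd e (lt y hy x hx h).ne'
  -- Ranks are distinct and lie between `1` and `s.card`, so counting shows that all of these values
  -- occur.
  have himg : s.image r = (Finset.range s.card).image (· + 1) := by
    refine Finset.eq_of_subset_of_card_le (fun z hz => ?_) ?_
    · obtain ⟨x, hx, rfl⟩ := Finset.mem_image.1 hz
      have h1 : 0 < r x := Finset.card_pos.2 ⟨x, Finset.mem_filter.2 ⟨hx, le_rfl⟩⟩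
      have h2 : r x ≤ s.card := Finset.card_filter_le _ _
      exact Finset.mem_image.2 ⟨r x - 1, Finset.mem_range.2 (by omega), by omega⟩
    · rw [Finset.card_image_of_injOn inj, Finset.card_image_of_injective _
        (fun a b e => by simpa using e), Finset.card_range]
  rw [← Finset.sum_image (f := F) inj, himg, Finset.sum_image (fun a _ b _ e => by simpa using e)]

end

/-! ### The states of the algorithm -/

section

variable {V : Type*} [Fintype V] [PartialOrder V]

/-- `w` may occur just before the step with value `i`, if the signs of the original labeling are
taken from `E`: the labels greater than `i` are in their final positions. -/
structure IsState (E : Finset ℤ) (i : ℕ) (w : V → ℤ) : Prop where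
  inj : ∀ x y, |w x| = |w y| → x = y
  range : ∀ x, 1 ≤ |w x| ∧ |w x| ≤ Fintype.card V
  sign_mem : ∀ x, (w x).sign ∈ E
  frozen : ∀ x, (i : ℤ) < |w x| → 0 < w x ∧ ∀ y, x ≤ y → w x ≤ w y

theorem IsState.ne_zero {E : Finset ℤ} {i : ℕ} {w : V → ℤ} (h : IsState E i w) (x : V) :
    w x ≠ 0 := fun h0 => by
  have := (h.range x).1
  rw [h0, abs_zero] at this
  omega

theorem IsState.exists_abs_eq {E : Finset ℤ} {i : ℕ} {w : V → ℤ} (h : IsState E i w) {k : ℕ}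
    (h1 : 1 ≤ k) (hk : k ≤ Fintype.card V) : ∃ x, |w x| = k := by
  classical
  have himg : Finset.univ.image (fun x => |w x|) = Finset.Icc (1 : ℤ) (Fintype.card V) := by
    refine Finset.eq_of_subset_of_card_le (fun z hz => ?_) ?_
    · obtain ⟨x, -, rfl⟩ := Finset.mem_image.1 hz
      exact Finset.mem_Icc.2 (h.range x)
    · rw [Finset.card_image_of_injective _ (fun x y e => h.inj x y e)]
      simp
  have : (k : ℤ) ∈ Finset.univ.image (fun x => |w x|) := by
    rw [himg, Finset.mem_Icc]
    omega
  obtain ⟨x, -, hx⟩ := Finset.mem_image.1 this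
  exact ⟨x, hx⟩

theorem IsStepPair.unique {E : Finset ℤ} {i j : ℕ} {w : V → ℤ} (hw : IsState E i w)
    {v u v' u' : V} (h : IsStepPair w j v u) (h' : IsStepPair w j v' u') : v = v' ∧ u = u' := by
  have e : v = v' := hw.inj _ _ (h.1.trans h'.1.symm)
  subst e
  exact ⟨rfl, h.2.unique h'.2⟩

/-- The ancestors of `v` form a chain, so a maximal candidate for `u` is the greatest one. -/
theorem IsState.exists_stepPair (hF : IsForest V) {E : Finset ℤ} {i j : ℕ} {w : V → ℤ}
    (h : IsState E j w) (hi : 1 ≤ i) (hn : i ≤ Fintype.card V) :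
    ∃ v u, IsStepPair w i v u := by
  classical
  obtain ⟨v, hv⟩ := h.exists_abs_eq hi hn
  obtain ⟨u, hu⟩ := (Set.toFinite {x | v ≤ x ∧ |w x| ≤ i}).exists_maximal ⟨v, le_rfl, hv.le⟩
  refine ⟨v, u, hv, hu.1, fun x hx => ?_⟩
  rcases hF v x u hx.1 hu.1.1 with h1 | h1
  · exact h1
  · exact hu.2 hx h1

theorem sortStep_eq {E : Finset ℤ} {i j : ℕ} {w : V → ℤ} (hw : IsState E j w) {v u : V}
    (h : IsStepPair w i v u) :
    sortStep i w = (stepWeight w v u, signSwap w u v (w v).sign) := by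
  have hex : ∃ p : V × V, IsStepPair w i p.1 p.2 := ⟨(v, u), h⟩
  have e := IsStepPair.unique hw hex.choose_spec h
  rw [sortStep, dif_pos hex, e.1, e.2, stepLabeling_eq _ (hw.ne_zero v)]

section step

variable {E : Finset ℤ} {i : ℕ} {w : V → ℤ} {v u : V}

/-- A step leads from states to states. -/
theorem IsState.signSwap (hE : IsSignSet E) (hw : IsState E (i + 1) w)
    (h : IsStepPair w (i + 1) v u) : IsState E i (signSwap w u v (w v).sign) := by
  classical
  have hε := hE.eq_one_or _ (hw.sign_mem v)
  have hv : |w v| = i + 1 := by have := h.1; push_cast at this; exact this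
  have hu : |w u| ≤ i + 1 := by have := h.2.1.2; push_cast at this; exact this
  have hlarge : ∀ x, (i + 1 : ℤ) < |w x| → LabeledForest.signSwap w u v (w v).sign x = w x :=
    fun x hx => signSwap_of_ne _ _ (by rintro rfl; omega) (by rintro rfl; omega)
  refine ⟨fun x y e => ?_, fun x => ?_, sign_signSwap_mem hE hw.sign_mem u v (hw.sign_mem v),
    fun x hx => ?_⟩
  · rw [abs_signSwap _ _ _ hε, abs_signSwap _ _ _ hε] at e
    exact (Equiv.swap u v).injective (hw.inj _ _ e)
  · rw [abs_signSwap _ _ _ hε]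
    exact hw.range _
  by_cases hxu : x = u
  · have e := h.signSwap_left
    push_cast at e
    rw [hxu, e]
    refine ⟨by omega, fun y hy => ?_⟩
    by_cases hyu : y = u
    · rw [hyu, e]
    -- A proper ancestor of `u` with a smaller label would contradict the choice of `u` as greatest.
    have hy2 : (i + 1 : ℤ) < |w y| := by
      by_contra hle
      refine hyu (le_antisymm (h.2.2 ⟨h.2.1.1.trans hy, ?_⟩) hy)
      push_cast
      omega
    rw [hlarge y hy2]
    have := (hw.frozen y (by push_cast; exact hy2)).1
    rw [abs_of_pos this] at hy2
    exact hy2.le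
  · have hx2 : (i + 1 : ℤ) < |w x| := by
      rw [abs_signSwap _ _ _ hε] at hx
      by_cases hxv : x = v
      · rw [hxv, Equiv.swap_apply_right] at hx
        have : u = v := hw.inj _ _ (by omega)
        exact absurd (hxv.trans this.symm) hxu
      rw [Equiv.swap_apply_of_ne_of_ne hxu hxv] at hx
      have : |w x| ≠ i + 1 := fun e => hxv (hw.inj _ _ (e.trans hv.symm))
      omega
    obtain ⟨h1, h2⟩ := hw.frozen x (by push_cast; exact hx2)
    rw [hlarge x hx2]
    refine ⟨h1, fun y hy => ?_⟩
    have h3 := h2 y hy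
    rw [abs_of_pos h1] at hx2
    rw [hlarge y (by rw [abs_of_pos (by omega)]; omega)]
    exact h3

/-- A label beyond `i + 1` is frozen, so every vertex above it, including `u`, would have a label at
least as large. -/
theorem IsState.abs_le_of_le (hw : IsState E i w) (hu : w u = i + 1) {x : V} (hx : x ≤ u) :
    |w x| ≤ i + 1 := by
  by_contra hlt
  obtain ⟨h1, h2⟩ := hw.frozen x (by omega)
  have := h2 u hx
  rw [abs_of_pos h1] at hlt
  omega

/-- Steps can be undone: any vertex `v ≤ u` and any sign is possible. -/
theorem IsState.signSwap_inv (hF : IsForest V) (hE : IsSignSet E) (hw : IsState E i w)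
    (hu : w u = i + 1) (hvu : v ≤ u) {ε : ℤ} (hεE : ε ∈ E) :
    IsState E (i + 1) (LabeledForest.signSwap w u v ε) ∧
      IsStepPair (LabeledForest.signSwap w u v ε) (i + 1) v u ∧
      (LabeledForest.signSwap w u v ε v).sign = ε := by
  classical
  have hε := hE.eq_one_or _ hεE
  have hv : |w v| ≤ i + 1 := hw.abs_le_of_le hu hvu
  have habs := abs_signSwap w u v hε
  have hlarge : ∀ x, (i + 1 : ℤ) < |w x| → x ≠ u ∧ x ≠ v := fun x hx =>
    ⟨by rintro rfl; rw [hu, abs_of_pos] at hx <;> omega, by rintro rfl; omega⟩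
  have hsv : LabeledForest.signSwap w u v ε v = ε * (i + 1) := by rw [signSwap_right, hu]
  refine ⟨⟨fun x y e => ?_, fun x => ?_, sign_signSwap_mem hE hw.sign_mem u v hεE,
    fun x hx => ?_⟩, ⟨?_, ⟨hvu, ?_⟩, fun x hx => ?_⟩, ?_⟩
  · rw [habs, habs] at e
    exact (Equiv.swap u v).injective (hw.inj _ _ e)
  · rw [habs]
    exact hw.range _
  · push_cast at hx
    have hx' : x ≠ u ∧ x ≠ v := by
      rw [habs] at hx
      constructor
      · rintro rfl; rw [Equiv.swap_apply_left] at hx; omega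
      · rintro rfl; rw [Equiv.swap_apply_right, hu, abs_of_pos] at hx <;> omega
    rw [signSwap_of_ne _ _ hx'.1 hx'.2] at hx ⊢
    obtain ⟨h1, h2⟩ := hw.frozen x (by omega)
    refine ⟨h1, fun y hy => ?_⟩
    have h3 := h2 y hy
    rw [abs_of_pos h1] at hx
    have h4 := hlarge y (by rw [abs_of_pos (by omega)]; omega)
    rw [signSwap_of_ne _ _ h4.1 h4.2]
    exact h3
  · rw [habs, Equiv.swap_apply_right, hu, abs_of_pos (by omega)]
    push_cast
    rfl
  · rw [habs, Equiv.swap_apply_left]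
    push_cast
    exact hv
  · obtain ⟨hx1, hx2⟩ := hx
    -- By the forest property `x` is comparable with `u`. Strictly above `u` the labels are frozen
    -- and exceed `i + 1`, so `x` is no candidate.
    rcases hF v x u hx1 hvu with h1 | h1
    · exact h1
    by_contra hxu
    have hne : x ≠ u := by rintro rfl; exact hxu le_rfl
    have h2 := (hw.frozen u (by rw [hu, abs_of_pos] <;> omega)).2 x h1
    have h3 : w x ≠ w u := fun e => hne (hw.inj _ _ (by rw [e]))
    have h4 : (i + 1 : ℤ) < |w x| := by rw [abs_of_pos (by omega)]; omega
    have h5 := hlarge x h4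
    rw [signSwap_of_ne _ _ h5.1 h5.2] at hx2
    push_cast at hx2
    omega
  · rw [hsv, Int.sign_mul, Int.sign_eq_one_of_pos (a := (i + 1 : ℤ)) (by omega), mul_one]
    rcases hε with rfl | rfl <;> rfl

open Classical in
/-- The rank of the absolute value of the label of `v` in the subtree rooted at `u`. -/
noncomputable def rank (w : V → ℤ) (u v : V) : ℕ :=
  (Finset.univ.filter fun y => y ≤ u ∧ |w y| ≤ |w v|).card

theorem rank_le_hook (w : V → ℤ) (u v : V) : rank w u v ≤ hook u := by
  refine Finset.card_le_card fun y hy => ?_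
  simp only [Finset.mem_filter, Finset.mem_univ, true_and] at hy ⊢
  exact hy.1

/-- After the interchange `v` carries the largest absolute value in the subtree of `u`, hence
induced absolute value `h_u`. The new label of `u` has the rank that `v` had in `w`, because the
transposition permutes the subtree. -/
theorem stepWeight_signSwap (hw : IsState E i w) (hu : w u = i + 1) (hvu : v ≤ u) {ε : ℤ}
    (hε : ε = 1 ∨ ε = -1) :
    stepWeight (LabeledForest.signSwap w u v ε) v u =
      if 0 < ε * w v then (hook u : ℤ) - rank w u v else hook u + rank w u v - 1 := by
  classical
  have habs := abs_signSwap w u v hε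
  have hle : ∀ y, y ≤ u → Equiv.swap u v y ≤ u := fun y hy => by
    by_cases h1 : y = u
    · rw [h1, Equiv.swap_apply_left]; exact hvu
    by_cases h2 : y = v
    · rw [h2, Equiv.swap_apply_right]
    rwa [Equiv.swap_apply_of_ne_of_ne h1 h2]
  have hεa : |ε| = 1 := by rcases hε with rfl | rfl <;> rfl
  have e1 : |inducedLabel (LabeledForest.signSwap w u v ε) u v| = hook u := by
    have hne : LabeledForest.signSwap w u v ε v ≠ 0 := by
      rw [signSwap_right]
      refine mul_ne_zero (by rintro rfl; simp at hεa) (hw.ne_zero u)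
    have hs : |(LabeledForest.signSwap w u v ε v).sign| = 1 := by
      rcases sign_eq_one_or hne with h | h <;> rw [h] <;> rfl
    rw [inducedLabel, abs_mul, hs, one_mul, Nat.abs_cast, hook]
    congr 2
    refine Finset.filter_congr fun y _ => ⟨fun h => h.1, fun h => ⟨h, ?_⟩⟩
    rw [habs, habs, Equiv.swap_apply_right, hu, abs_of_pos (a := (i + 1 : ℤ)) (by omega)]
    exact hw.abs_le_of_le hu (hle y h)
  have e2 : (Finset.univ.filter fun y => y ≤ u ∧ |LabeledForest.signSwap w u v ε y| ≤
      |LabeledForest.signSwap w u v ε u|).card = rank w u v := by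
    refine Finset.card_bij (fun y _ => Equiv.swap u v y) (fun y hy => ?_)
      (fun _ _ _ _ e => (Equiv.swap u v).injective e)
      (fun y hy => ⟨Equiv.swap u v y, ?_, Equiv.swap_apply_self _ _ _⟩)
    · simp only [Finset.mem_filter, Finset.mem_univ, true_and, habs,
        Equiv.swap_apply_left] at hy ⊢
      exact ⟨hle _ hy.1, hy.2⟩
    · simp only [Finset.mem_filter, Finset.mem_univ, true_and, habs,
        Equiv.swap_apply_left, Equiv.swap_apply_self] at hy ⊢
      exact ⟨hle _ hy.1, hy.2⟩
  have e3 : inducedLabel (LabeledForest.signSwap w u v ε) u u = (ε * w v).sign * rank w u v := by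
    rw [inducedLabel, e2, LabeledForest.signSwap_left]
  rw [stepWeight, e1, e3, LabeledForest.signSwap_left]
  split_ifs with h
  · rw [Int.sign_eq_one_of_pos h, one_mul]
  · have h0 : ε * w v ≠ 0 := mul_ne_zero (by rintro rfl; simp at hεa) (hw.ne_zero v)
    rw [Int.sign_eq_neg_one_of_neg (by omega)]
    ring

open Classical in
theorem sum_rank_subtree {M : Type*} [AddCommMonoid M] (hw : IsState E i w) (u : V) (F : ℕ → M) :
    ∑ v ∈ Finset.univ.filter (· ≤ u), F (rank w u v) =
      ∑ k ∈ Finset.range (hook u), F (k + 1) := by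
  have := sum_rank (s := Finset.univ.filter (· ≤ u)) (f := fun x => |w x|)
    (fun x _ y _ e => hw.inj x y e) F
  simp only [Finset.filter_filter] at this
  exact this

end step

end

/-! ### The generating function, one step at a time -/

section

variable {V : Type*} [Fintype V] [PartialOrder V] {R : Type*} [CommRing R]

open Classical in
/-- The contribution of a step to the generating function: trivial steps are marked by `t`. -/
noncomputable def stepFactor (q : R) (t : V → R) (w : V → ℤ) (v u : V) : R :=
  q ^ (stepWeight w v u).toNat * if v = u ∧ 0 < w v then t u else 1

open Classical in
/-- The product of the contributions of the steps with values `i, …, 1`. -/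
noncomputable def runFactor (q : R) (t : V → R) : ℕ → (V → ℤ) → R
  | 0, _ => 1
  | i + 1, w =>
    (if h : ∃ p : V × V, IsStepPair w (i + 1) p.1 p.2 then
      stepFactor q t w h.choose.1 h.choose.2 else 1) * runFactor q t i (sortStep (i + 1) w).2

theorem runFactor_succ {q : R} {t : V → R} {E : Finset ℤ} {i j : ℕ} {w : V → ℤ}
    (hw : IsState E j w) {v u : V} (h : IsStepPair w (i + 1) v u) :
    runFactor q t (i + 1) w =
      stepFactor q t w v u * runFactor q t i (signSwap w u v (w v).sign) := by
  have hex : ∃ p : V × V, IsStepPair w (i + 1) p.1 p.2 := ⟨(v, u), h⟩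
  have e := IsStepPair.unique hw hex.choose_spec h
  rw [runFactor, dif_pos hex, e.1, e.2, sortStep_eq hw h]

/-- The mark is split off as an additive correction: in the trivial positive step the power of `q`
is `1`, so replacing it by `t u` adds `t u - 1`. -/
theorem stepFactor_signSwap {q : R} {t : V → R} {E : Finset ℤ} {i : ℕ} {w : V → ℤ} {v u : V}
    [DecidableEq V] (hw : IsState E i w) (hu : w u = i + 1) (hvu : v ≤ u) {ε : ℤ}
    (hε : ε = 1 ∨ ε = -1) :
    stepFactor q t (signSwap w u v ε) v u =
      q ^ (if 0 < ε * w v then hook u - rank w u v else hook u + rank w u v - 1) +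
        if v = u then if ε = 1 then t u - 1 else 0 else 0 := by
  have hr := rank_le_hook w u v
  have e : (stepWeight (signSwap w u v ε) v u).toNat =
      if 0 < ε * w v then hook u - rank w u v else hook u + rank w u v - 1 := by
    rw [stepWeight_signSwap hw hu hvu hε]
    split_ifs <;> omega
  rw [stepFactor, e, signSwap_right, hu]
  by_cases hv : v = u
  · subst hv
    rcases hε with rfl | rfl
    -- The label `i + 1` is the largest in its subtree, so the exponent vanishes.
    · have h0 : rank w v v = hook v := by
        classical
        refine congrArg Finset.card (Finset.filter_congr fun y _ => ?_)
        refine ⟨fun h => h.1, fun h => ⟨h, ?_⟩⟩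
        have := hw.abs_le_of_le hu h
        rw [hu, abs_of_pos (a := (i + 1 : ℤ)) (by omega)]
        exact this
      have h1 : (0 : ℤ) < w v := by omega
      have h2 : (0 : ℤ) < (i : ℤ) + 1 := by omega
      simp only [one_mul, if_pos h1, if_true, true_and, if_pos h2, h0, Nat.sub_self, pow_zero]
      ring
    · have h2 : ¬ (0 : ℤ) < -1 * (i + 1) := by omega
      simp only [h2, and_false, if_false, if_true, mul_one]
      simp
  · simp [hv]

open Classical in
theorem sum_stepFactor {q : R} {t : V → R} {E : Finset ℤ} (hE : IsSignSet E) {i : ℕ}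
    {w : V → ℤ} {u : V} (hw : IsState E i w) (hu : w u = i + 1) :
    ∑ v ∈ Finset.univ.filter (· ≤ u), ∑ ε ∈ E, stepFactor q t (signSwap w u v ε) v u =
      (∑ v ∈ Finset.univ.filter (· ≤ u), ∑ ε ∈ E,
        q ^ (if 0 < ε * w v then hook u - rank w u v else hook u + rank w u v - 1)) - 1 + t u := by
  have h1 : ∀ v ∈ Finset.univ.filter (· ≤ u), ∑ ε ∈ E, stepFactor q t (signSwap w u v ε) v u =
      (∑ ε ∈ E, q ^ (if 0 < ε * w v then hook u - rank w u v else hook u + rank w u v - 1)) +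
        if v = u then t u - 1 else 0 := fun v hv => by
    rw [Finset.sum_congr rfl fun ε hε => stepFactor_signSwap hw hu (Finset.mem_filter.1 hv).2
      (hE.eq_one_or ε hε), Finset.sum_add_distrib]
    congr 1
    split_ifs
    · rw [Finset.sum_ite_eq' E 1, if_pos hE.one_mem]
    · exact Finset.sum_const_zero
  rw [Finset.sum_congr rfl h1, Finset.sum_add_distrib, Finset.sum_ite_eq', if_pos (by simp)]
  ring

open Classical in
theorem sum_stepFactor_pos {q : R} {t : V → R} {i : ℕ}
    {w : V → ℤ} {u : V} (hw : IsState {1} i w) (hu : w u = i + 1) :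
    ∑ v ∈ Finset.univ.filter (· ≤ u), ∑ ε ∈ {1}, stepFactor q t (signSwap w u v ε) v u =
      qInt q (hook u) - 1 + t u := by
  rw [sum_stepFactor ⟨by simp, by simp⟩ hw hu]
  congr 2
  have : ∀ v ∈ Finset.univ.filter (· ≤ u), ∑ ε ∈ {(1 : ℤ)},
      q ^ (if 0 < ε * w v then hook u - rank w u v else hook u + rank w u v - 1) =
        q ^ (hook u - rank w u v) := fun v _ => by
    have h := hw.sign_mem v
    rw [Finset.mem_singleton, Int.sign_eq_one_iff_pos] at h
    rw [Finset.sum_singleton, one_mul, if_pos h]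
  rw [Finset.sum_congr rfl this, sum_rank_subtree hw u (fun k => q ^ (hook u - k)), qInt,
    ← Finset.sum_range_reflect (fun k => q ^ k)]
  exact Finset.sum_congr rfl fun k _ => by rw [Nat.add_comm k, Nat.sub_sub]

open Classical in
theorem sum_stepFactor_signed {q : R} {t : V → R} {i : ℕ}
    {w : V → ℤ} {u : V} (hw : IsState {1, -1} i w) (hu : w u = i + 1) :
    ∑ v ∈ Finset.univ.filter (· ≤ u), ∑ ε ∈ {1, -1}, stepFactor q t (signSwap w u v ε) v u =
      qInt q (2 * hook u) - 1 + t u := by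
  rw [sum_stepFactor ⟨by simp, by simp⟩ hw hu]
  congr 2
  have : ∀ v ∈ Finset.univ.filter (· ≤ u), ∑ ε ∈ {(1 : ℤ), -1},
      q ^ (if 0 < ε * w v then hook u - rank w u v else hook u + rank w u v - 1) =
        q ^ (hook u - rank w u v) + q ^ (hook u + rank w u v - 1) := fun v _ => by
    have h := hw.ne_zero v
    rw [Finset.sum_pair (by decide)]
    -- Whatever the sign of `w v`, exactly one of the two choices of `ε` makes `ε * w v` positive; a
    -- negative `w v` only swaps the two terms.
    rcases lt_or_gt_of_ne h with h | h
    · rw [if_neg (by omega), if_pos (by omega), add_comm]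
    · rw [if_pos (by omega), if_neg (by omega)]
  rw [Finset.sum_congr rfl this,
    -- The first powers fill the exponents below `h_u`, the second those from `h_u` to `2 h_u - 1`.
    sum_rank_subtree hw u (fun k => q ^ (hook u - k) + q ^ (hook u + k - 1)), qInt, two_mul,
    Finset.sum_range_add, Finset.sum_add_distrib, ← Finset.sum_range_reflect (fun k => q ^ k)]
  congr 1
  exact Finset.sum_congr rfl fun k _ => by rw [Nat.add_comm k, Nat.sub_sub]

/-! ### Summation over all states of a level. -/

open Classical in
variable (V) in
/-- The set of all states. -/
noncomputable def states (E : Finset ℤ) (i : ℕ) : Finset (V → ℤ) :=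
  (Fintype.piFinset fun _ =>
    Finset.Icc (-(Fintype.card V : ℤ)) (Fintype.card V)).filter (IsState E i)

theorem mem_states {E : Finset ℤ} {i : ℕ} {w : V → ℤ} : w ∈ states V E i ↔ IsState E i w := by
  simp only [states, Finset.mem_filter, Fintype.mem_piFinset, Finset.mem_Icc,
    and_iff_right_iff_imp]
  exact fun h v => abs_le.1 (h.range v).2

open Classical in
-- States of level `i + 1` correspond to triples of a state of level `i`, a vertex below its vertex
-- labeled `i + 1`, and a sign. Summing out the last two yields the factor `c` of that vertex.
theorem sum_states_succ (hF : IsForest V) {E : Finset ℤ} (hE : IsSignSet E) {q : R} {t c : V → R}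
    {i : ℕ} (hi : i + 1 ≤ Fintype.card V)
    (hc : ∀ (w : V → ℤ) (u : V), IsState E i w → w u = i + 1 →
      ∑ v ∈ Finset.univ.filter (· ≤ u), ∑ ε ∈ E, stepFactor q t (signSwap w u v ε) v u = c u) :
    ∑ w ∈ states V E (i + 1),
        (∏ v ∈ Finset.univ.filter (fun v => ((i + 1 : ℕ) : ℤ) < |w v|), c v) *
          runFactor q t (i + 1) w =
      ∑ w ∈ states V E i, (∏ v ∈ Finset.univ.filter (fun v => (i : ℤ) < |w v|), c v) *
        runFactor q t i w := by
  have hne : Nonempty V := Fintype.card_pos_iff.1 (by omega)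
  set top : (V → ℤ) → V := fun w => Classical.epsilon fun x => w x = i + 1 with htop
  have top_spec : ∀ w, IsState E i w → w (top w) = i + 1 := fun w hw => by
    refine Classical.epsilon_spec (p := fun x => w x = i + 1) ?_
    obtain ⟨x, hx⟩ := hw.exists_abs_eq (k := i + 1) (by omega) hi
    push_cast at hx
    refine ⟨x, ?_⟩
    rw [← hx, abs_of_pos (hw.frozen x (by omega)).1]
  have main : ∑ a ∈ (states V E i).sigma
        (fun w => (Finset.univ.filter (· ≤ top w)) ×ˢ E),
        (∏ v ∈ Finset.univ.filter (fun v => ((i + 1 : ℕ) : ℤ) < |a.1 v|), c v) *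
          (stepFactor q t (signSwap a.1 (top a.1) a.2.1 a.2.2) a.2.1 (top a.1) *
            runFactor q t i a.1) =
      ∑ w ∈ states V E (i + 1),
        (∏ v ∈ Finset.univ.filter (fun v => ((i + 1 : ℕ) : ℤ) < |w v|), c v) *
          runFactor q t (i + 1) w := by
    refine Finset.sum_bij (fun a _ => signSwap a.1 (top a.1) a.2.1 a.2.2) ?_ ?_ ?_ ?_
    · rintro ⟨w, v, ε⟩ ha
      simp only [Finset.mem_sigma, Finset.mem_product, Finset.mem_filter, Finset.mem_univ,
        true_and, mem_states] at ha ⊢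
      exact (ha.1.signSwap_inv hF hE (top_spec w ha.1) ha.2.1 ha.2.2).1
    · rintro ⟨w, v, ε⟩ ha ⟨w', v', ε'⟩ ha' e
      simp only [Finset.mem_sigma, Finset.mem_product, Finset.mem_filter, Finset.mem_univ,
        true_and, mem_states] at ha ha' e
      have h := ha.1.signSwap_inv hF hE (top_spec w ha.1) ha.2.1 ha.2.2
      have h' := ha'.1.signSwap_inv hF hE (top_spec w' ha'.1) ha'.2.1 ha'.2.2
      rw [← e] at h'
      -- The image determines its step pair and the sign; applying the same signed interchange again
      -- recovers the state.
      obtain ⟨e1, e2⟩ := IsStepPair.unique h.1 h.2.1 h'.2.1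
      have e3 : ε = ε' := by rw [← h.2.2, ← h'.2.2, e1]
      have hε := hE.eq_one_or _ ha.2.2
      have e4 := congrArg (fun z => signSwap z (top w) v ε) e
      rw [signSwap_signSwap _ _ _ hε, e2, e3, e1, signSwap_signSwap _ _ _ (e3 ▸ hε)] at e4
      subst e4 e1 e3
      rfl
    · intro w hw
      rw [mem_states] at hw
      obtain ⟨v, u, h⟩ := hw.exists_stepPair hF (i := i + 1) (by omega) hi
      have hs := hw.signSwap hE h
      have htu : top (signSwap w u v (w v).sign) = u := by
        refine hs.inj _ _ ?_
        rw [top_spec _ hs, h.signSwap_left]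
        push_cast
        rfl
      refine ⟨⟨signSwap w u v (w v).sign, v, (w v).sign⟩, ?_, ?_⟩
      · simp only [Finset.mem_sigma, Finset.mem_product, Finset.mem_filter, Finset.mem_univ,
          true_and, mem_states]
        exact ⟨hs, by rw [htu]; exact h.2.1.1, hw.sign_mem v⟩
      · rw [htu, signSwap_signSwap _ _ _ (sign_eq_one_or (hw.ne_zero v))]
    · rintro ⟨w, v, ε⟩ ha
      simp only [Finset.mem_sigma, Finset.mem_product, Finset.mem_filter, Finset.mem_univ,
        true_and, mem_states] at ha ⊢
      have hu := top_spec w ha.1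
      have h := ha.1.signSwap_inv hF hE hu ha.2.1 ha.2.2
      have hε := hE.eq_one_or _ ha.2.2
      rw [runFactor_succ h.1 h.2.1, h.2.2, signSwap_signSwap _ _ _ hε]
      congr 1
      refine Finset.prod_congr (Finset.filter_congr fun x _ => ?_) fun _ _ => rfl
      have hv := ha.1.abs_le_of_le hu ha.2.1
      rw [abs_signSwap _ _ _ hε]
      have hu' : |w (top w)| = i + 1 := by rw [hu, abs_of_pos]; omega
      push_cast
      by_cases h1 : x = top w
      · rw [h1, Equiv.swap_apply_left]
        omega
      by_cases h2 : x = v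
      · rw [h2, Equiv.swap_apply_right]
        omega
      rw [Equiv.swap_apply_of_ne_of_ne h1 h2]
  rw [← main, Finset.sum_sigma]
  refine Finset.sum_congr rfl fun w hw => ?_
  rw [mem_states] at hw
  have hu := top_spec w hw
  have hu' : |w (top w)| = i + 1 := by rw [hu, abs_of_pos]; omega
  -- Lowering the threshold by one adds only the vertex labeled `i + 1`.
  have hfil : Finset.univ.filter (fun v => (i : ℤ) < |w v|) =
      insert (top w) (Finset.univ.filter (fun v => ((i + 1 : ℕ) : ℤ) < |w v|)) := by
    ext x
    simp only [Finset.mem_filter, Finset.mem_univ, true_and, Finset.mem_insert]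
    push_cast
    constructor
    · intro hx
      by_cases h : |w x| = i + 1
      · exact Or.inl (hw.inj _ _ (h.trans hu'.symm))
      · exact Or.inr (by omega)
    · rintro (rfl | h) <;> omega
  rw [hfil, Finset.prod_insert (by simp [hu']), ← hc w _ hw hu, Finset.sum_product]
  simp only [← Finset.mul_sum, ← Finset.sum_mul]
  ring

open Classical in
-- The weighted sum is the same at every level: at level `n` the product of the `c v` is empty, at
-- level `0` it is complete and no steps remain.
theorem sum_states_card (hF : IsForest V) {E : Finset ℤ} (hE : IsSignSet E) {q : R} {t c : V → R}
    (hc : ∀ (i : ℕ) (w : V → ℤ) (u : V), IsState E i w → w u = i + 1 →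
      ∑ v ∈ Finset.univ.filter (· ≤ u), ∑ ε ∈ E, stepFactor q t (signSwap w u v ε) v u = c u) :
    ∑ w ∈ states V E (Fintype.card V), runFactor q t (Fintype.card V) w =
      (states V E 0).card • ∏ v, c v := by
  have key : ∀ i ≤ Fintype.card V, ∑ w ∈ states V E i,
      (∏ v ∈ Finset.univ.filter (fun v => (i : ℤ) < |w v|), c v) * runFactor q t i w =
        (states V E 0).card • ∏ v, c v := by
    intro i
    induction i with
    | zero =>
      intro _
      rw [← Finset.sum_const]
      refine Finset.sum_congr rfl fun w hw => ?_
      rw [mem_states] at hw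
      rw [runFactor, mul_one, Finset.filter_true_of_mem]
      intro x _
      have := (hw.range x).1
      push_cast
      omega
    | succ i ih => exact fun hi => (sum_states_succ hF hE hi (hc i)).trans (ih (by omega))
  rw [← key _ le_rfl]
  refine Finset.sum_congr rfl fun w hw => ?_
  rw [mem_states] at hw
  rw [Finset.filter_false_of_mem fun x _ => not_lt.2 (hw.range x).2, Finset.prod_empty, one_mul]

end

/-! ### Minimal cycle vertices -/

section

variable {V : Type*} [Fintype V] [PartialOrder V] {R : Type*} [CommRing R]

open Classical in
/-- The permutation that takes the final labeling to `w`, and the product of the contributions of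
the steps in terms of its balanced cycles. -/
theorem exists_perm_runFactor (hF : IsForest V) {E : Finset ℤ} (hE : IsSignSet E) (q : R)
    (t : V → R) (i : ℕ) (hi : i ≤ Fintype.card V) (w : V → ℤ) (hw : IsState E i w) :
    ∃ σ : Equiv.Perm ℤ, (∀ k, σ (-k) = -σ k) ∧ (∀ k : ℤ, (i : ℤ) < |k| → σ k = k) ∧
      (∀ x, σ ((sortFrom i w).2 x) = w x) ∧ IsState E 0 (sortFrom i w).2 ∧
      (∀ x, (i : ℤ) < |w x| → (sortFrom i w).2 x = w x) ∧
      (∀ x, |w x| ≤ i → |(sortFrom i w).2 x| ≤ i) ∧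
      runFactor q t i w = q ^ (sortFrom i w).1.toNat *
        ∏ v ∈ Finset.univ.filter (fun v => (sortFrom i w).2 v ≤ i ∧
          IsBalancedMin σ ((sortFrom i w).2 v)), t v := by
  induction i generalizing w with
  | zero =>
    refine ⟨1, fun k => rfl, fun k _ => rfl, fun x => rfl, hw, fun x _ => rfl, fun x h => h, ?_⟩
    rw [Finset.filter_false_of_mem]
    · simp [runFactor, sortFrom]
    · rintro x - ⟨h, -⟩
      have := hw.frozen x (by have := (hw.range x).1; push_cast; omega)
      simp only [sortFrom] at h
      push_cast at h
      omega
  | succ i ih =>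
    obtain ⟨v, u, h⟩ := hw.exists_stepPair hF (i := i + 1) (by omega) hi
    have hs := hw.signSwap hE h
    have hε := sign_eq_one_or (hw.ne_zero v)
    have hu1 := h.signSwap_left
    have hsort : sortStep (i + 1) w = (stepWeight w v u, signSwap w u v (w v).sign) :=
      sortStep_eq hw h
    set w₁ := signSwap w u v (w v).sign with hw₁
    obtain ⟨σ, hodd, hsupp, hσ, h0, hfix, hle, hrun⟩ := ih (by omega) w₁ hs
    have hsnd : (sortFrom (i + 1) w).2 = (sortFrom i w₁).2 := by rw [sortFrom, hsort]
    have hfst : (sortFrom (i + 1) w).1 = stepWeight w v u + (sortFrom i w₁).1 := by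
      rw [sortFrom, hsort]
    rw [hsnd, hfst]
    set w' := (sortFrom i w₁).2 with hw'
    have hv : |w v| = i + 1 := by have := h.1; push_cast at this; exact this
    have hu : |w u| ≤ i + 1 := by have := h.2.1.2; push_cast at this; exact this
    have hu1' : |w₁ u| = i + 1 := by rw [hu1, abs_of_pos] <;> push_cast <;> omega
    -- Later steps leave the label `i + 1` on `u`, so the vertex marked in this step is the one with
    -- final label `i + 1`.
    have hw'u : w' u = ((i + 1 : ℕ) : ℤ) := by rw [hfix u (by omega), hu1]
    have hpos : ∀ x, 0 < w' x := fun x =>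
      (h0.frozen x (by have := (h0.range x).1; push_cast; omega)).1
    have hne : ∀ x, x ≠ u → |w' x| ≠ (i + 1 : ℕ) := fun x hx e => by
      refine hx (h0.inj _ _ ?_)
      rw [e, hw'u, Nat.abs_cast]
    have hfix' : ∀ x, ((i + 1 : ℕ) : ℤ) < |w x| → w' x = w x := fun x hx => by
      push_cast at hx
      have e : w₁ x = w x :=
        signSwap_of_ne _ _ (by rintro rfl; omega) (by rintro rfl; omega)
      rw [hfix x (by rw [e]; omega), e]
    have hle' : ∀ x, |w x| ≤ (i + 1 : ℕ) → |w' x| ≤ (i + 1 : ℕ) := fun x hx => by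
      by_cases hxu : x = u
      · rw [hxu, hw'u, Nat.abs_cast]
      have hx1 : |w₁ x| ≤ i + 1 := by
        rw [hw₁, abs_signSwap _ _ _ hε]
        by_cases hxv : x = v
        · rw [hxv, Equiv.swap_apply_right]; exact hu
        · rw [Equiv.swap_apply_of_ne_of_ne hxu hxv]; push_cast at hx; exact hx
      have hx2 : |w₁ x| ≠ i + 1 := fun e => hxu (hs.inj _ _ (e.trans hu1'.symm))
      have := hle x (by omega)
      push_cast
      omega
    -- the description of the contributions, given the permutation
    have finish : ∀ τ : Equiv.Perm ℤ,
        (∀ m : ℤ, |m| ≤ i → (IsBalancedMin τ m ↔ IsBalancedMin σ m)) →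
        (IsBalancedMin τ ((i + 1 : ℕ) : ℤ) ↔ v = u ∧ 0 < w v) →
        runFactor q t (i + 1) w = q ^ (stepWeight w v u + (sortFrom i w₁).1).toNat *
          ∏ x ∈ Finset.univ.filter (fun x => w' x ≤ (i + 1 : ℕ) ∧ IsBalancedMin τ (w' x)), t x := by
      intro τ h1 h2
      have hfil : Finset.univ.filter
          (fun x => w' x ≤ (i + 1 : ℕ) ∧ IsBalancedMin τ (w' x)) =
          (if v = u ∧ 0 < w v then {u} else ∅) ∪
            Finset.univ.filter (fun x => w' x ≤ i ∧ IsBalancedMin σ (w' x)) := by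
        ext x
        simp only [Finset.mem_union, Finset.mem_filter, Finset.mem_univ, true_and]
        by_cases hxu : x = u
        · rw [hxu, hw'u, h2]
          by_cases h3 : v = u ∧ 0 < w v
          · rw [if_pos h3]
            exact ⟨fun _ => Or.inl (Finset.mem_singleton_self u), fun _ => ⟨le_rfl, h3⟩⟩
          · simp [h3]
        · have h3 : x ∉ (if v = u ∧ 0 < w v then {u} else ∅ : Finset V) := by
            split_ifs <;> simp [hxu]
          have h4 := hne x hxu
          have h5 := hpos x
          rw [abs_of_pos h5] at h4
          push_cast at h4 ⊢
          simp only [h3, false_or]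
          constructor
          · rintro ⟨h6, h7⟩
            have h8 : w' x ≤ i := by omega
            exact ⟨h8, (h1 _ (by rwa [abs_of_pos h5])).1 h7⟩
          · rintro ⟨h6, h7⟩
            exact ⟨by omega, (h1 _ (by rwa [abs_of_pos h5])).2 h7⟩
      have hdisj : Disjoint (if v = u ∧ 0 < w v then {u} else ∅ : Finset V)
          (Finset.univ.filter (fun x => w' x ≤ i ∧ IsBalancedMin σ (w' x))) := by
        rw [Finset.disjoint_left]
        intro x hx hx'
        have hxu : x = u := by
          split_ifs at hx
          · simpa using hx
          · simp at hx
        rw [Finset.mem_filter, hxu, hw'u] at hx'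
        have := hx'.2.1
        push_cast at this
        omega
      rw [runFactor_succ hw h, hrun, hfil, Finset.prod_union hdisj, stepFactor,
        Int.toNat_add (stepWeight_nonneg (by omega) h) (sortFrom_nonneg _ _), pow_add]
      have : ∏ x ∈ (if v = u ∧ 0 < w v then {u} else ∅ : Finset V), t x =
          if v = u ∧ 0 < w v then t u else 1 := by
        split_ifs <;> simp
      rw [this]
      ring
    have habs : ∀ k : ℤ, ((i + 1 : ℕ) : ℤ) < |k| → (i : ℤ) < |k| := fun k hk => by
      push_cast at hk
      omega
    by_cases hvu : v = u
    · subst hvu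
      have hother : ∀ x, x ≠ v → σ (w' x) = w x := fun x hx => by
        rw [hσ, hw₁, signSwap_of_ne _ _ hx hx]
      rcases hε with hs1 | hs1
      · have hwv : 0 < w v := by rwa [Int.sign_eq_one_iff_pos] at hs1
        refine ⟨σ, hodd, fun k hk => hsupp k (habs k hk), fun x => ?_, h0, hfix', hle',
          finish σ (fun _ _ => Iff.rfl) ⟨fun _ => ⟨rfl, hwv⟩, fun _ => ?_⟩⟩
        · by_cases hx : x = v
          · rw [hx, hσ, hu1, ← h.1, abs_of_pos hwv]
          · exact hother x hx
        · refine isBalancedMin_of_fixed (by push_cast; omega) (hsupp _ ?_)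
          rw [Nat.abs_cast]
          push_cast
          omega
      · have hwv : w v < 0 := by rwa [Int.sign_eq_neg_one_iff_neg] at hs1
        obtain ⟨τ, t1, t2, t3, t4, t5, t6⟩ := exists_perm_neg hodd hsupp
        refine ⟨τ, t1, t2, fun x => ?_, h0, hfix', hle', finish τ t6
          ⟨fun H => absurd H t5, fun H => absurd H.2 (by omega)⟩⟩
        by_cases hx : x = v
        · rw [hx, hw'u, t3]
          rw [abs_of_neg hwv] at hv
          push_cast
          omega
        · rw [t4 _ (hne x hx), hother x hx]
    · have hv1 : |w₁ v| ≤ i := by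
        have h1 : |w₁ v| ≤ i + 1 := by
          rw [hw₁, abs_signSwap _ _ _ hε, Equiv.swap_apply_right]; exact hu
        have h2 : |w₁ v| ≠ i + 1 := fun e => hvu (hs.inj _ _ (e.trans hu1'.symm))
        omega
      have hv' := hle v hv1
      have hεa : |(w v).sign| = 1 := by rcases hε with e | e <;> rw [e] <;> rfl
      have hba : |(w v).sign * w' v| = |w' v| := by rw [abs_mul, hεa, one_mul]
      have hεσ : ∀ k, σ ((w v).sign * k) = (w v).sign * σ k := fun k => by
        rcases hε with e | e <;> rw [e] <;> simp [hodd]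
      -- With `ε` the sign of `w v`, the choice `b = ε * w' v` is forced: `τ (w' u) = w u = ε * w₁ v
      -- = σ (ε * w' v)`. Then oddness gives `τ (w' v) = ε * (i + 1) = w v`.
      obtain ⟨τ, t1, t2, t3, t4, t5, t6, t7⟩ := exists_perm_insert hodd hsupp
        (b := (w v).sign * w' v) (fun e => by
          rw [e, abs_zero] at hba; have := hpos v; rw [abs_of_pos this] at hba; omega)
        (by rw [hba]; exact hv')
      refine ⟨τ, t1, t2, fun x => ?_, h0, hfix', hle', finish τ t7
          ⟨fun H => absurd H t6, fun H => absurd H.1 hvu⟩⟩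
      by_cases hxu : x = u
      · rw [hxu, hw'u, t3, hεσ, hσ, hw₁, signSwap_right, ← mul_assoc]
        rcases hε with e | e <;> rw [e] <;> ring
      by_cases hxv : x = v
      · rw [hxv]
        have e1 : τ (w' v) = (w v).sign * τ ((w v).sign * w' v) := by
          rcases hε with e | e <;> rw [e] <;> simp [t1]
        rw [e1, t4, ← h.1, Int.sign_mul_abs]
      rw [t5 _ (hne x hxu) (fun e => hxv (h0.inj _ _ (e.trans hba))), hσ, hw₁,
        signSwap_of_ne _ _ hxu hxv]

end

/-! ### Labelings and initial states -/

theorem card_labelings (V : Type*) [Fintype V] : (labelings V).card = (Fintype.card V)! := by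
  classical
  rw [← Fintype.card_equiv (Fintype.equivFin V), ← Finset.card_univ]
  symm
  refine Finset.card_bij (fun e _ x => ((e x : ℕ) : ℤ) + 1) (fun e _ => ?_) (fun e _ e' _ h => ?_)
    (fun w hw => ?_)
  · rw [mem_labelings]
    refine ⟨fun x _ => ?_, fun x _ y _ h => ?_, fun k hk => ?_⟩
    · have := (e x).2
      simp only [Set.mem_Icc]
      omega
    · simp only [add_left_inj, Nat.cast_inj] at h
      exact e.injective (Fin.ext h)
    · obtain ⟨h1, h2⟩ := hk
      refine ⟨e.symm ⟨(k - 1).toNat, by omega⟩, trivial, ?_⟩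
      simp only [Equiv.apply_symm_apply]
      omega
  · ext x
    have := congrFun h x
    simpa using this
  · rw [mem_labelings] at hw
    have hr : ∀ x, 1 ≤ w x ∧ w x ≤ Fintype.card V := fun x => hw.mapsTo (Set.mem_univ x)
    have hb : Function.Bijective
        (fun x : V => (⟨(w x - 1).toNat, by have := hr x; omega⟩ : Fin (Fintype.card V))) := by
      rw [Fintype.bijective_iff_injective_and_card]
      refine ⟨fun x y h => hw.injOn trivial trivial ?_, by simp⟩
      have h1 := hr x
      have h2 := hr y
      simp only [Fin.mk.injEq] at h
      omega
    refine ⟨Equiv.ofBijective _ hb, Finset.mem_univ _, funext fun x => ?_⟩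
    have := hr x
    simp only [Equiv.ofBijective_apply]
    omega

section

variable {V : Type*} [Fintype V] [PartialOrder V]

/-- At level `n` no label is frozen, so only the conditions on absolute values and signs remain. -/
theorem isState_card_iff {w : V → ℤ} :
    IsState {1, -1} (Fintype.card V) w ↔ IsSignedLabeling w := by
  constructor
  · intro h
    refine ⟨fun x y e => h.inj _ _ (by rw [e]), fun v => ⟨h.ne_zero v, (h.range v).2⟩, ?_⟩
    rintro _ ⟨x, rfl⟩ ⟨y, hy⟩
    have := h.inj x y (by rw [hy, abs_neg])
    have h0 := h.ne_zero x
    subst this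
    omega
  · rintro ⟨h1, h2, h3⟩
    refine ⟨fun x y e => ?_, fun x => ⟨?_, (h2 x).2⟩, fun x => ?_,
      fun x hx => absurd (h2 x).2 (not_le.2 hx)⟩
    · rcases abs_eq_abs.1 e with e | e
      · exact h1 e
      · exact absurd ⟨x, e⟩ (h3 _ ⟨y, rfl⟩)
    · have := abs_pos.2 (h2 x).1
      omega
    · rcases sign_eq_one_or (h2 x).1 with e | e <;> simp [e]

theorem isState_one_card_iff {w : V → ℤ} :
    IsState {1} (Fintype.card V) w ↔ IsLabeling w := by
  constructor
  · intro h
    have hpos : ∀ x, 0 < w x := fun x => by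
      have := h.sign_mem x
      rwa [Finset.mem_singleton, Int.sign_eq_one_iff_pos] at this
    refine ⟨fun x _ => ?_, fun x _ y _ e => h.inj _ _ (by rw [e]), fun k hk => ?_⟩
    · have := h.range x
      rwa [abs_of_pos (hpos x)] at this
    · obtain ⟨k, rfl⟩ := Int.eq_ofNat_of_zero_le (zero_le_one.trans hk.1)
      obtain ⟨x, hx⟩ := h.exists_abs_eq (k := k) (by exact_mod_cast hk.1) (by exact_mod_cast hk.2)
      rw [abs_of_pos (hpos x)] at hx
      exact ⟨x, trivial, hx⟩
  · intro h
    have hr : ∀ x, 1 ≤ w x ∧ w x ≤ Fintype.card V := fun x => h.mapsTo (Set.mem_univ x)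
    have habs : ∀ x, |w x| = w x := fun x => abs_of_pos (by have := hr x; omega)
    refine ⟨fun x y e => ?_, fun x => ?_, fun x => ?_, fun x hx => ?_⟩
    · rw [habs, habs] at e
      exact h.injOn trivial trivial e
    · rw [habs]; exact hr x
    · rw [Finset.mem_singleton, Int.sign_eq_one_iff_pos]
      have := hr x
      omega
    · rw [habs] at hx
      have := hr x
      omega

theorem IsState.zero_pos {E : Finset ℤ} {w : V → ℤ} (h : IsState E 0 w) (x : V) : 0 < w x :=
  (h.frozen x (by have := (h.range x).1; push_cast; omega)).1

/-- At level `0` every label is frozen, hence positive; this is why both formulas have the same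
constant. -/
theorem states_zero {E : Finset ℤ} (hE : IsSignSet E) : states V E 0 = states V {1} 0 := by
  ext w
  rw [mem_states, mem_states]
  refine ⟨fun h => ⟨h.inj, h.range, fun x => ?_, h.frozen⟩,
    fun h => ⟨h.inj, h.range, fun x => ?_, h.frozen⟩⟩
  · rw [Finset.mem_singleton, Int.sign_eq_one_iff_pos]
    exact h.zero_pos x
  · rw [Int.sign_eq_one_iff_pos.2 (h.zero_pos x)]
    exact hE.one_mem

theorem IsState.zero_exists {E : Finset ℤ} {w : V → ℤ} (h : IsState E 0 w) {k : ℤ} (h1 : 1 ≤ k)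
    (h2 : k ≤ Fintype.card V) : ∃ x, w x = k := by
  obtain ⟨k, rfl⟩ := Int.eq_ofNat_of_zero_le (zero_le_one.trans h1)
  obtain ⟨x, hx⟩ := h.exists_abs_eq (k := k) (by exact_mod_cast h1) (by exact_mod_cast h2)
  rw [abs_of_pos (h.zero_pos x)] at hx
  exact ⟨x, hx⟩

/-! ### Identification of the minimal cycle vertices. -/

open Classical in
theorem cycB_eq {E : Finset ℤ} {w : V → ℤ} {σ : Equiv.Perm ℤ} (hodd : ∀ k, σ (-k) = -σ k)
    (hsupp : ∀ k : ℤ, (Fintype.card V : ℤ) < |k| → σ k = k) (hσ : ∀ x, σ (sorted w x) = w x)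
    (h0 : IsState E 0 (sorted w)) :
    cycB w = Finset.univ.filter fun v => sorted w v ≤ Fintype.card V ∧
      IsBalancedMin σ (sorted w v) := by
  have hr : ∀ x, 1 ≤ sorted w x ∧ sorted w x ≤ Fintype.card V := fun x => by
    have := h0.range x
    rwa [abs_of_pos (h0.zero_pos x)] at this
  refine Finset.filter_congr fun v _ => ⟨?_, fun h => ⟨σ, ⟨hodd, hsupp⟩, hσ, ?_⟩⟩
  · rintro ⟨τ, ⟨hτ1, hτ2⟩, hτ3, hτ4⟩
    have pos : ∀ k : ℤ, 1 ≤ k → τ k = σ k := fun k hk => by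
      by_cases hkn : k ≤ Fintype.card V
      · obtain ⟨x, rfl⟩ := h0.zero_exists hk hkn
        rw [hτ3, hσ]
      · have : (Fintype.card V : ℤ) < |k| := by rw [abs_of_pos] <;> omega
        rw [hτ2 k this, hsupp k this]
    -- The values of `sorted w` exhaust `1, …, n`, and oddness settles the rest: the existential has
    -- only one candidate.
    have e : τ = σ := by
      ext k
      rcases lt_trichotomy k 0 with hk | rfl | hk
      · have := pos (-k) (by omega)
        rw [hτ1, hodd] at this
        exact neg_injective this
      · have h1 := hτ1 0
        have h2 := hodd 0
        rw [neg_zero] at h1 h2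
        omega
      · exact pos k hk
    rw [e] at hτ4
    exact ⟨(hr v).2, (mem_permCycB hodd (hr v).1 (hr v).2).1 hτ4⟩
  · exact (mem_permCycB hodd (hr v).1 (hr v).2).2 h.2

open Classical in
-- For positive `w` the permutation `σ` preserves the positive numbers, so the cycles there are all
-- balanced. An element of `S_n` extending `w ∘ w'⁻¹` differs from `σ` at most off the positive
-- numbers, where it is the identity.
theorem cyc_eq {E : Finset ℤ} {w : V → ℤ} {σ : Equiv.Perm ℤ} (hodd : ∀ k, σ (-k) = -σ k)
    (hsupp : ∀ k : ℤ, (Fintype.card V : ℤ) < |k| → σ k = k) (hσ : ∀ x, σ (sorted w x) = w x)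
    (h0 : IsState E 0 (sorted w)) (hw : ∀ x, 0 < w x) :
    cyc w = Finset.univ.filter fun v => sorted w v ≤ Fintype.card V ∧
      IsBalancedMin σ (sorted w v) := by
  have hr : ∀ x, 1 ≤ sorted w x ∧ sorted w x ≤ Fintype.card V := fun x => by
    have := h0.range x
    rwa [abs_of_pos (h0.zero_pos x)] at this
  have hpos1 : ∀ k, 0 < k → 0 < σ k := fun k hk => by
    by_cases hkn : k ≤ Fintype.card V
    · obtain ⟨x, rfl⟩ := h0.zero_exists (by omega) hkn
      rw [hσ]
      exact hw x
    · rwa [hsupp k (by rw [abs_of_pos] <;> omega)]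
  have hpos : ∀ k, 0 < σ k ↔ 0 < k := fun k => by
    refine ⟨fun h => ?_, hpos1 k⟩
    by_contra hk
    rcases (not_lt.1 hk).eq_or_lt with rfl | hk
    · have := hodd 0
      rw [neg_zero] at this
      omega
    · have := hpos1 (-k) (by omega)
      rw [hodd] at this
      omega
  have key : ∀ τ : Equiv.Perm ℤ, (∀ k, 0 < k → τ k = σ k) → ∀ v,
      (sorted w v ∈ permCyc (Fintype.card V) τ ↔ IsBalancedMin σ (sorted w v)) := by
    intro τ hτ v
    have hv := hr v
    have hv0 : 0 < sorted w v := h0.zero_pos v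
    have fwd : ∀ k, σ.SameCycle (sorted w v) k → 0 < k ∧ τ.SameCycle (sorted w v) k :=
      fun k hk => sameCycle_map_on (τ := τ) (fun z => 0 < z) id hpos (fun x hx => by
        rw [id, id, ← hτ x hx]
        exact Equiv.Perm.sameCycle_apply_right.2 (.refl _ _)) hv0 hk
    have bwd : ∀ k, τ.SameCycle (sorted w v) k → σ.SameCycle (sorted w v) k := by
      -- values of `σ` are positive exactly on positive numbers, so `τ` permutes these as well
      have hpτ : ∀ x, 0 < τ x ↔ 0 < x := fun x => by
        refine ⟨fun h => ?_, fun h => by rw [hτ x h]; exact hpos1 x h⟩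
        have h1 : 0 < σ.symm (τ x) := by rwa [← hpos, Equiv.apply_symm_apply]
        have h2 := hτ _ h1
        rw [Equiv.apply_symm_apply] at h2
        rwa [τ.injective h2] at h1
      exact fun k hk => (sameCycle_map_on (τ := σ) (fun z => 0 < z) id hpτ (fun x hx => by
        rw [id, id, hτ x hx]
        exact Equiv.Perm.sameCycle_apply_right.2 (.refl _ _)) hv0 hk).2
    constructor
    · rintro ⟨-, -, h⟩
      refine ⟨fun k hk hk' => ?_, fun k hk => ?_⟩
      · have h1 := (fwd _ hk).1
        have h2 := (fwd _ hk').1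
        omega
      · have h1 := (fwd _ hk)
        rw [abs_of_pos h1.1, abs_of_pos (by omega)]
        exact h k h1.2
    · rintro ⟨-, h⟩
      refine ⟨hv.1, hv.2, fun k hk => ?_⟩
      have h1 := bwd k hk
      have h2 := (fwd k h1).1
      have h3 := h k h1
      rwa [abs_of_pos h2, abs_of_pos (by omega)] at h3
  refine Finset.filter_congr fun v _ => ⟨?_, fun h => ?_⟩
  · rintro ⟨τ, hτ1, hτ2, hτ3⟩
    refine ⟨(hr v).2, (key τ (fun k hk => ?_) v).1 hτ3⟩
    by_cases hkn : k ≤ Fintype.card V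
    · obtain ⟨x, rfl⟩ := h0.zero_exists (by omega) hkn
      rw [hτ2, hσ]
    · rw [hτ1 k (by omega), hsupp k (by rw [abs_of_pos] <;> omega)]
  -- The element of `S_n` is `σ` on the positive numbers and the identity elsewhere.
  · set τ : Equiv.Perm ℤ := Equiv.Perm.ofSubtype (σ.subtypePerm (p := fun z => 0 < z) hpos) with hτ
    have hτσ : ∀ k, 0 < k → τ k = σ k := fun k hk => by
      rw [hτ, Equiv.Perm.ofSubtype_apply_of_mem _ hk]
      rfl
    refine ⟨τ, fun k hk => ?_, fun x => ?_, (key τ hτσ v).2 h.2⟩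
    · by_cases hk0 : 0 < k
      · rw [hτσ k hk0, hsupp]
        rw [abs_of_pos hk0]
        omega
      · rw [hτ, Equiv.Perm.ofSubtype_apply_of_not_mem _ hk0]
    · rw [hτσ _ (h0.zero_pos x), hσ]

/-! ### The hook length formula. -/

theorem runFactor_one (i : ℕ) (w : V → ℤ) : runFactor (1 : ℚ) (fun _ => 1) i w = 1 := by
  induction i generalizing w with
  | zero => rfl
  | succ i ih =>
    rw [runFactor, ih]
    split_ifs <;> simp [stepFactor]

theorem states_one_card : states V {1} (Fintype.card V) = labelings V := by
  ext w
  rw [mem_states, mem_labelings, isState_one_card_iff]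

theorem states_card : states V {1, -1} (Fintype.card V) = signedLabelings V := by
  ext w
  rw [mem_states, mem_signedLabelings, isState_card_iff]

/-- The hook length formula: the increasing labelings are counted by `n! / ∏ h_v`. -/
theorem card_states_zero (hF : IsForest V) :
    ((states V {1} 0).card : ℚ) = (Fintype.card V)! / ∏ v : V, (hook v : ℚ) := by
  -- With all variables `1` each labeling counts once and each vertex contributes `h_v`.
  have h := sum_states_card hF (E := {1}) ⟨by simp, by simp⟩ (q := (1 : ℚ)) (t := fun _ : V => 1)
    (c := fun v => qInt 1 (hook v) - 1 + 1) (fun i w u hw hu => sum_stepFactor_pos hw hu)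
  simp only [runFactor_one, Finset.sum_const, states_one_card, card_labelings, nsmul_eq_mul,
    mul_one, qInt, one_pow, Finset.card_range, sub_add_cancel] at h
  rw [h, mul_div_cancel_right₀]
  refine Finset.prod_ne_zero_iff.2 fun v _ => Nat.cast_ne_zero.2 ?_
  classical
  exact (Finset.card_pos.2 ⟨v, by simp⟩).ne'

end

end LabeledForest

theorem mainTheorem2 {V : Type*} [Fintype V] [PartialOrder V] (hF : LabeledForest.IsForest V)
    {R : Type*} [CommRing R] [Algebra ℚ R] (q : R) (t : V → R) :
    (∑ w ∈ LabeledForest.labelings V,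
        q ^ (LabeledForest.sor w).toNat * ∏ v ∈ LabeledForest.cyc w, t v =
      (((Fintype.card V)! : ℚ) / ∏ v : V, (LabeledForest.hook v : ℚ)) •
        ∏ v : V, (LabeledForest.qInt q (LabeledForest.hook v) - 1 + t v)) ∧
    (∑ w ∈ LabeledForest.signedLabelings V,
        q ^ (LabeledForest.sorB w).toNat * ∏ v ∈ LabeledForest.cycB w, t v =
      (((Fintype.card V)! : ℚ) / ∏ v : V, (LabeledForest.hook v : ℚ)) •
        ∏ v : V, (LabeledForest.qInt q (2 * LabeledForest.hook v) - 1 + t v)) := by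
  classical
  have hA : LabeledForest.IsSignSet {1} := ⟨by simp, by simp⟩
  have hB : LabeledForest.IsSignSet {1, -1} := ⟨by simp, by simp⟩
  -- The rational constant is the number of increasing labelings, so both right-hand sides become
  -- sums of `runFactor`, to be compared term by term.
  rw [← LabeledForest.card_states_zero hF, Nat.cast_smul_eq_nsmul, Nat.cast_smul_eq_nsmul,
    ← LabeledForest.sum_states_card hF hA (q := q) (t := t)
      (fun i w u hw hu => LabeledForest.sum_stepFactor_pos hw hu),
    ← LabeledForest.states_zero hB,
    ← LabeledForest.sum_states_card hF hB (q := q) (t := t)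
      (fun i w u hw hu => LabeledForest.sum_stepFactor_signed hw hu),
    LabeledForest.states_one_card, LabeledForest.states_card]
  refine ⟨Finset.sum_congr rfl fun w hw => ?_, Finset.sum_congr rfl fun w hw => ?_⟩
  · rw [LabeledForest.mem_labelings] at hw
    obtain ⟨σ, h1, h2, h3, h4, -, -, h5⟩ := LabeledForest.exists_perm_runFactor hF hA q t
      _ le_rfl w (LabeledForest.isState_one_card_iff.2 hw)
    rw [h5, LabeledForest.cyc_eq h1 h2 h3 h4 fun x => (hw.mapsTo (Set.mem_univ x)).1]
    rfl
  · rw [LabeledForest.mem_signedLabelings] at hw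
    obtain ⟨σ, h1, h2, h3, h4, -, -, h5⟩ := LabeledForest.exists_perm_runFactor hF hB q t
      _ le_rfl w (LabeledForest.isState_card_iff.2 hw)
    rw [h5, LabeledForest.cycB_eq h1 h2 h3 h4]
    rfl
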